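/- **Conventions.** Let $N$ be a Kähler manifold of complex dimension $m$: a smooth manifold of real dimension $2m$ with a Riemannian metric $\langle\cdot,\cdot\rangle$ and an integrable almost complex structure $J$ such that $\langle JU,JV\rangle=\langle U,V\rangle$ and the 2-form $\Phi(U,V)=\langle U,JV\rangle$ is closed. Let $(M,g)$ be an $m$-dimensional Riemannian manifold and $\phi:M\to N$ a smooth isometric immersion that is Lagrangian, i.e. $J(d\phi(T_xM))\perp d\phi(T_xM)$ for all $x\in M$; $T_xM$ is identified with $d\phi(T_xM)$. Let $\nabla,\nabla^N$ be the Levi-Civita connections of $M$ and $N$, $\overline\nabla$ the connection on $\phi^{-1}TN$ induced by $\nabla^N$, $\nabla^\perp$ the normal connection, $B(X,Y)=\overline\nabla_X d\phi(Y)-d\phi(\nabla_XY)$ the second fundamental form, and $A_\xi$ the shape operator, $\langle A_\xi X,Y\rangle=\langle B(X,Y),\xi\rangle$. Curvature is $R(U,V)=\nabla_U\nabla_V-\nabla_V\nabla_U-\nabla_{[U,V]}$ (likewise $R^N$), and $Ric(Z,X)=\sum_i\langle R(Z,e_i)e_i,X\rangle$ for an orthonormal basis (likewise $Ric^N$, over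 an orthonormal basis of $T_pN$). Below, $(e_i)_{i=1}^m$ is an orthonormal basis of $T_xM$, extended to a local frame where it is differentiated. The tension field is $\tau(\phi)=\sum_iB(e_i,e_i)$, the mean curvature vector field is $\mathbf H=\frac1m\tau(\phi)$, and the rough Laplacians on sections of $\phi^{-1}TN$ and on normal fields are $$\overline\Delta=-\sum_i\big(\overline\nabla_{e_i}\overline\nabla_{e_i}-\overline\nabla_{\nabla_{e_i}e_i}\big),\qquad \Delta^\perp=-\sum_i\big(\nabla^\perp_{e_i}\nabla^\perp_{e_i}-\nabla^\perp_{\nabla_{e_i}e_i}\big).$$ The map $\phi$ is *biharmonic* if its bitension field vanishes: $\tau_2(\phi)=\overline\Delta\,\tau(\phi)-\sum_iR^N(\tau(\phi),d\phi(e_i))d\phi(e_i)=0$. Finally $(\nabla_XA_{\mathbf H})(Y)=\nabla_X(A_{\mathbf H}Y)-A_{\mathbf H}(\nabla_XY)$ and $(\nabla^\perp_XB)(Y,Z)=\nabla^\perp_X(B(Y,Z))-B(\nabla_XY,Z)-B(Y,\nabla_XZ)$. **Theorem.** The Lagrangian isometric immersion $\phi$ is biharmonic if and only if the following two equations hold at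 every point of $M$: $$\sum_i(\nabla_{e_i}A_{\mathbf H})(e_i)+\sum_iA_{\nabla^\perp_{e_i}\mathbf H}(e_i)-\sum_{i}\Big\langle \sum_j(\nabla^\perp_{e_i}B)(e_j,e_j)-\sum_j(\nabla^\perp_{e_j}B)(e_i,e_j),\ \mathbf H\Big\rangle e_i=0,$$ $$\Delta^\perp\mathbf H+\sum_iB(A_{\mathbf H}e_i,e_i)+\sum_iRic^N(J\mathbf H,e_i)\,Je_i-\sum_iRic(J\mathbf H,e_i)\,Je_i-J\sum_iA_{B(J\mathbf H,e_i)}(e_i)+m\,JA_{\mathbf H}(J\mathbf H)=0,$$ where $J\mathbf H$, which is tangent to $M$, is regarded as a tangent vector of $M$ in $Ric$, $B$ and $A_{\mathbf H}$. -/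

import Mathlib

open Bundle Manifold ContDiff
open FiberBundle (extend)
open Module (finrank)

noncomputable section

namespace LagrangianBiharmonic

/-! ### The Levi-Civita connection, curvature and traces on one Riemannian manifold

Manifolds are smooth, without boundary, and modelled on a finite-dimensional real vector space. -/

section OneManifold

variable {E : Type*} [NormedAddCommGroup E] [NormedSpace ℝ E] [FiniteDimensional ℝ E]
  {M : Type*} [TopologicalSpace M] [ChartedSpace E M] [IsManifold 𝓘(ℝ, E) ∞ M]
  [RiemannianBundle (fun x : M ↦ TangentSpace 𝓘(ℝ, E) x)]
  [IsContMDiffRiemannianBundle 𝓘(ℝ, E) ∞ E (fun x : M ↦ TangentSpace 𝓘(ℝ, E) x)]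

instance (x : M) : FiniteDimensional ℝ (TangentSpace 𝓘(ℝ, E) x) :=
  inferInstanceAs (FiniteDimensional ℝ E)

set_option linter.unusedSectionVars false in
lemma mdiff_inner {x : M} {X Y : Π x : M, TangentSpace 𝓘(ℝ, E) x}
    (hX : MDiffAt (T% X) x) (hY : MDiffAt (T% Y) x) : MDiffAt (fun y ↦ inner ℝ (X y) (Y y)) x :=
  MDifferentiableAt.inner_bundle (IB := 𝓘(ℝ, E)) (F := E)
    (E := fun x : M ↦ TangentSpace 𝓘(ℝ, E) x) (b := fun y ↦ y) hX hY

/-- The value at `x` of the right-hand side of Koszul's formula for `⟨∇_X Y, Z⟩`. -/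
def koszul (X Y Z : Π x : M, TangentSpace 𝓘(ℝ, E) x) (x : M) : ℝ :=
  (1 / 2 : ℝ) *
    (mvfderiv 𝓘(ℝ, E) (fun y ↦ inner ℝ (Y y) (Z y)) x (X x)
      + mvfderiv 𝓘(ℝ, E) (fun y ↦ inner ℝ (X y) (Z y)) x (Y x)
      - mvfderiv 𝓘(ℝ, E) (fun y ↦ inner ℝ (X y) (Y y)) x (Z x)
      + inner ℝ (VectorField.mlieBracket 𝓘(ℝ, E) X Y x) (Z x)
      - inner ℝ (VectorField.mlieBracket 𝓘(ℝ, E) X Z x) (Y x)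
      - inner ℝ (VectorField.mlieBracket 𝓘(ℝ, E) Y Z x) (X x))

lemma koszul_tensorial_left {x : M} {Y Z : Π x : M, TangentSpace 𝓘(ℝ, E) x}
    (hY : MDiffAt (T% Y) x) (hZ : MDiffAt (T% Z) x) :
    TensorialAt 𝓘(ℝ, E) E (koszul · Y Z x) x where
  smul {f X} hf hX := by
    simp only [koszul, Pi.smul_apply', inner_smul_left, smul_eq_mul,
      VectorField.mlieBracket_smul_left hf hX]
    simp [mvfderiv_fun_mul hf (mdiff_inner hX hZ), mvfderiv_fun_mul hf (mdiff_inner hX hY), inner_add_left,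
      inner_smul_left, inner_smul_right]
    ring
  add {X X'} hX hX' := by
    simp [koszul, inner_add_left, inner_add_right,
      mvfderiv_fun_add (mdiff_inner hX hZ) (mdiff_inner hX' hZ),
      mvfderiv_fun_add (mdiff_inner hX hY) (mdiff_inner hX' hY),
      VectorField.mlieBracket_add_left hX hX']
    ring

lemma koszul_tensorial_right {x : M} {X Y : Π x : M, TangentSpace 𝓘(ℝ, E) x}
    (hX : MDiffAt (T% X) x) (hY : MDiffAt (T% Y) x) :
    TensorialAt 𝓘(ℝ, E) E (koszul X Y · x) x where
  smul {f Z} hf hZ := by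
    simp only [koszul, Pi.smul_apply', inner_smul_right, smul_eq_mul,
      VectorField.mlieBracket_smul_right hf hZ]
    simp [mvfderiv_fun_mul hf (mdiff_inner hX hZ), mvfderiv_fun_mul hf (mdiff_inner hY hZ), inner_add_left,
      inner_smul_left]
    rw [real_inner_comm (X x) (Z x), real_inner_comm (Y x) (Z x)]
    ring
  add {Z Z'} hZ hZ' := by
    simp [koszul, inner_add_left, inner_add_right,
      mvfderiv_fun_add (mdiff_inner hX hZ) (mdiff_inner hX hZ'),
      mvfderiv_fun_add (mdiff_inner hY hZ) (mdiff_inner hY hZ'),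
      VectorField.mlieBracket_add_right hZ hZ']
    ring

/-- For a vector field `Y` differentiable at `x`, the bilinear form `(u, w) ↦ ⟨∇_u Y, w⟩` on `T_xM`
given by Koszul's formula. -/
def koszulForm (Y : Π x : M, TangentSpace 𝓘(ℝ, E) x) (x : M) (hY : MDiffAt (T% Y) x) :
    TangentSpace 𝓘(ℝ, E) x →L[ℝ] TangentSpace 𝓘(ℝ, E) x →L[ℝ] ℝ :=
  TensorialAt.mkHom₂ (fun X Z ↦ koszul X Y Z x) x
    (fun _ hZ ↦ koszul_tensorial_left hY hZ) (fun _ hX ↦ koszul_tensorial_right hX hY)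

open Classical in
/-- The endomorphism `u ↦ ∇_u Y` of `T_xM` that represents Koszul's form. (The value for a field
that is not differentiable at `x` is irrelevant.) -/
def leviCivitaFun (Y : Π x : M, TangentSpace 𝓘(ℝ, E) x) (x : M) :
    TangentSpace 𝓘(ℝ, E) x →L[ℝ] TangentSpace 𝓘(ℝ, E) x :=
  if hY : MDiffAt (T% Y) x then
    ∑ i, ((koszulForm Y x hY).flip (stdOrthonormalBasis ℝ (TangentSpace 𝓘(ℝ, E) x) i)).smulRight
      (stdOrthonormalBasis ℝ (TangentSpace 𝓘(ℝ, E) x) i)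
  else 0

lemma inner_leviCivitaFun {x : M} {X Y Z : Π x : M, TangentSpace 𝓘(ℝ, E) x}
    (hX : MDiffAt (T% X) x) (hY : MDiffAt (T% Y) x) (hZ : MDiffAt (T% Z) x) :
    inner ℝ (leviCivitaFun Y x (X x)) (Z x) = koszul X Y Z x := by
  have h : koszulForm Y x hY (X x) (Z x) = koszul X Y Z x :=
    TensorialAt.mkHom₂_apply (fun _ hZ ↦ koszul_tensorial_left hY hZ)
      (fun _ hX ↦ koszul_tensorial_right hX hY) hX hZ
  rw [← h]
  conv_rhs => rw [← (stdOrthonormalBasis ℝ (TangentSpace 𝓘(ℝ, E) x)).sum_repr' (Z x)]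
  simp [leviCivitaFun, hY, sum_inner, inner_smul_left, mul_comm]

set_option linter.unusedSectionVars false in
lemma eq_of_inner_extend {x : M} {u v : TangentSpace 𝓘(ℝ, E) x}
    (h : ∀ Z : Π x : M, TangentSpace 𝓘(ℝ, E) x, MDiffAt (T% Z) x →
      inner ℝ u (Z x) = inner ℝ v (Z x)) : u = v := by
  refine ext_inner_right ℝ fun w ↦ ?_
  have := h (extend E w) (FiberBundle.mdifferentiableAt_extend 𝓘(ℝ, E) E w)
  simpa using this

lemma clm_eq_of_extend {x : M} {A B : TangentSpace 𝓘(ℝ, E) x →L[ℝ] TangentSpace 𝓘(ℝ, E) x}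
    (h : ∀ X Z : Π x : M, TangentSpace 𝓘(ℝ, E) x, MDiffAt (T% X) x → MDiffAt (T% Z) x →
      inner ℝ (A (X x)) (Z x) = inner ℝ (B (X x)) (Z x)) : A = B := by
  ext v
  have := eq_of_inner_extend fun Z hZ ↦ h (extend E v) Z (FiberBundle.mdifferentiableAt_extend 𝓘(ℝ, E) E v) hZ
  simpa using this

lemma koszul_add_mid {x : M} {X Y Y' Z : Π x : M, TangentSpace 𝓘(ℝ, E) x}
    (hX : MDiffAt (T% X) x) (hY : MDiffAt (T% Y) x) (hY' : MDiffAt (T% Y') x)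
    (hZ : MDiffAt (T% Z) x) :
    koszul X (Y + Y') Z x = koszul X Y Z x + koszul X Y' Z x := by
  simp [koszul, inner_add_left, inner_add_right,
    mvfderiv_fun_add (mdiff_inner hY hZ) (mdiff_inner hY' hZ),
    mvfderiv_fun_add (mdiff_inner hX hY) (mdiff_inner hX hY'),
    VectorField.mlieBracket_add_right hY hY', VectorField.mlieBracket_add_left hY hY']
  ring

lemma koszul_smul_mid {x : M} {f : M → ℝ} {X Y Z : Π x : M, TangentSpace 𝓘(ℝ, E) x}
    (hf : MDiffAt f x) (hX : MDiffAt (T% X) x) (hY : MDiffAt (T% Y) x) (hZ : MDiffAt (T% Z) x) :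
    koszul X (f • Y) Z x = f x * koszul X Y Z x + mvfderiv 𝓘(ℝ, E) f x (X x) * inner ℝ (Y x) (Z x) := by
  simp only [koszul, Pi.smul_apply', inner_smul_right, inner_smul_left,
    VectorField.mlieBracket_smul_right hf hY, VectorField.mlieBracket_smul_left hf hY]
  simp [mvfderiv_fun_mul hf (mdiff_inner hY hZ), mvfderiv_fun_mul hf (mdiff_inner hX hY),
    inner_add_left, inner_smul_left]
  rw [real_inner_comm (Y x) (X x)]
  ring

variable (E M) in
/-- The Levi-Civita connection of a Riemannian manifold: `leviCivita E M Y x u` is `(∇_u Y)(x)`. -/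
def leviCivita : CovariantDerivative 𝓘(ℝ, E) E (fun x : M ↦ TangentSpace 𝓘(ℝ, E) x) where
  toFun := leviCivitaFun
  isCovariantDerivativeOnUniv :=
    { add := by
        intro Y Y' x hY hY' _
        refine clm_eq_of_extend fun X Z hX hZ ↦ ?_
        have hs : MDiffAt (T% (Y + Y')) x := mdifferentiableAt_add_section hY hY'
        simp only [add_apply, inner_add_left]
        rw [inner_leviCivitaFun hX hs hZ, inner_leviCivitaFun hX hY hZ,
          inner_leviCivitaFun hX hY' hZ, koszul_add_mid hX hY hY' hZ]
      leibniz := by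
        intro Y f x hY hf _
        refine clm_eq_of_extend fun X Z hX hZ ↦ ?_
        have hs : MDiffAt (T% (f • Y)) x := hf.smul_section hY
        rw [inner_leviCivitaFun hX hs hZ, koszul_smul_mid hf hX hY hZ, ← inner_leviCivitaFun hX hY hZ]
        simp [inner_add_left, inner_smul_left] }

/-- The Levi-Civita connection is torsion free. -/
lemma leviCivita_torsion : (leviCivita E M).torsion = 0 := by
  rw [CovariantDerivative.torsion_eq_zero_iff]
  intro X Y x hX hY
  refine eq_of_inner_extend fun Z hZ ↦ ?_
  rw [inner_sub_left]
  change inner ℝ (leviCivitaFun Y x (X x)) (Z x) - inner ℝ (leviCivitaFun X x (Y x)) (Z x) = _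
  rw [inner_leviCivitaFun hX hY hZ, inner_leviCivitaFun hY hX hZ]
  simp only [koszul, VectorField.mlieBracket_swap_apply (V := Y) (W := X), inner_neg_left,
    real_inner_comm (X _) (Y _)]
  ring

/-- The Levi-Civita connection is compatible with the metric. -/
lemma leviCivita_metric {x : M} {X Y Z : Π x : M, TangentSpace 𝓘(ℝ, E) x}
    (hX : MDiffAt (T% X) x) (hY : MDiffAt (T% Y) x) (hZ : MDiffAt (T% Z) x) :
    mvfderiv 𝓘(ℝ, E) (fun y ↦ inner ℝ (Y y) (Z y)) x (X x) =
      inner ℝ (leviCivita E M Y x (X x)) (Z x) + inner ℝ (Y x) (leviCivita E M Z x (X x)) := by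
  change _ = inner ℝ (leviCivitaFun Y x (X x)) (Z x) + inner ℝ (Y x) (leviCivitaFun Z x (X x))
  rw [← real_inner_comm (Y x), inner_leviCivitaFun hX hY hZ, inner_leviCivitaFun hX hZ hY]
  simp only [koszul, VectorField.mlieBracket_swap_apply (V := Z) (W := Y), inner_neg_left,
    real_inner_comm (Y _) (Z _)]
  ring

/-- The metric trace `∑ i, b (e i) (e i)` over an orthonormal basis `e` of `T_xM`, for a bilinear
map `b`. -/
def trace {x : M} {W : Type*} [AddCommGroup W]
    (b : TangentSpace 𝓘(ℝ, E) x → TangentSpace 𝓘(ℝ, E) x → W) : W :=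
  ∑ i, b (stdOrthonormalBasis ℝ (TangentSpace 𝓘(ℝ, E) x) i)
    (stdOrthonormalBasis ℝ (TangentSpace 𝓘(ℝ, E) x) i)

/-- The curvature tensor `R(u, v)w = ∇_U ∇_V W - ∇_V ∇_U W - ∇_[U,V] W` at `x`, where `U, V, W` are
local vector fields that extend `u, v, w`. -/
def curvature {x : M} (u v w : TangentSpace 𝓘(ℝ, E) x) : TangentSpace 𝓘(ℝ, E) x :=
  leviCivita E M (fun y ↦ leviCivita E M (extend E w) y (extend E v y)) x u
    - leviCivita E M (fun y ↦ leviCivita E M (extend E w) y (extend E u y)) x v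
    - leviCivita E M (extend E w) x
        (VectorField.mlieBracket 𝓘(ℝ, E) (extend E u) (extend E v) x)

/-- The Ricci tensor `Ric(u, w) = ∑ i, ⟨R(u, e i)(e i), w⟩`. -/
def ricci {x : M} (u w : TangentSpace 𝓘(ℝ, E) x) : ℝ :=
  trace fun a b : TangentSpace 𝓘(ℝ, E) x ↦ inner ℝ (curvature u a b) w

/-- A Kähler structure on a Riemannian manifold: a smooth field `J` of endomorphisms of the tangent
spaces with `J² = -1` that is integrable (its Nijenhuis tensor vanishes), for which the metric is
Hermitian and the fundamental form `Φ(U, V) = ⟨U, J V⟩` is closed. -/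
structure IsKahler (J : Π p : M, TangentSpace 𝓘(ℝ, E) p →L[ℝ] TangentSpace 𝓘(ℝ, E) p) : Prop where
  smooth : ContMDiff 𝓘(ℝ, E) (𝓘(ℝ, E).prod 𝓘(ℝ, E →L[ℝ] E)) ∞ (fun p ↦
    (TotalSpace.mk' (E →L[ℝ] E) p (J p) : TotalSpace (E →L[ℝ] E)
      (fun p : M ↦ TangentSpace 𝓘(ℝ, E) p →L[ℝ] TangentSpace 𝓘(ℝ, E) p)))
  sq : ∀ (p : M) (v : TangentSpace 𝓘(ℝ, E) p), J p (J p v) = -v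
  hermitian : ∀ (p : M) (u v : TangentSpace 𝓘(ℝ, E) p), inner ℝ (J p u) (J p v) = inner ℝ u v
  integrable : ∀ (p : M) (X Y : Π q : M, TangentSpace 𝓘(ℝ, E) q),
    CMDiffAt ∞ (T% X) p → CMDiffAt ∞ (T% Y) p →
    VectorField.mlieBracket 𝓘(ℝ, E) (fun q ↦ J q (X q)) (fun q ↦ J q (Y q)) p
      - J p (VectorField.mlieBracket 𝓘(ℝ, E) (fun q ↦ J q (X q)) Y p)
      - J p (VectorField.mlieBracket 𝓘(ℝ, E) X (fun q ↦ J q (Y q)) p)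
      - VectorField.mlieBracket 𝓘(ℝ, E) X Y p = 0
  closed : ∀ (p : M) (X Y Z : Π q : M, TangentSpace 𝓘(ℝ, E) q),
    CMDiffAt ∞ (T% X) p → CMDiffAt ∞ (T% Y) p → CMDiffAt ∞ (T% Z) p →
    mvfderiv 𝓘(ℝ, E) (fun q ↦ inner ℝ (Y q) (J q (Z q))) p (X p)
      + mvfderiv 𝓘(ℝ, E) (fun q ↦ inner ℝ (Z q) (J q (X q))) p (Y p)
      + mvfderiv 𝓘(ℝ, E) (fun q ↦ inner ℝ (X q) (J q (Y q))) p (Z p)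
      - inner ℝ (VectorField.mlieBracket 𝓘(ℝ, E) X Y p) (J p (Z p))
      - inner ℝ (VectorField.mlieBracket 𝓘(ℝ, E) Y Z p) (J p (X p))
      - inner ℝ (VectorField.mlieBracket 𝓘(ℝ, E) Z X p) (J p (Y p)) = 0

end OneManifold

/-! ### Maps between Riemannian manifolds -/

section Maps

variable {E : Type*} [NormedAddCommGroup E] [NormedSpace ℝ E] [FiniteDimensional ℝ E]
  {M : Type*} [TopologicalSpace M] [ChartedSpace E M] [IsManifold 𝓘(ℝ, E) ∞ M]
  [RiemannianBundle (fun x : M ↦ TangentSpace 𝓘(ℝ, E) x)]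
  [IsContMDiffRiemannianBundle 𝓘(ℝ, E) ∞ E (fun x : M ↦ TangentSpace 𝓘(ℝ, E) x)]
  {F : Type*} [NormedAddCommGroup F] [NormedSpace ℝ F] [FiniteDimensional ℝ F]
  {N : Type*} [TopologicalSpace N] [ChartedSpace F N] [IsManifold 𝓘(ℝ, F) ∞ N]
  [RiemannianBundle (fun p : N ↦ TangentSpace 𝓘(ℝ, F) p)]
  [IsContMDiffRiemannianBundle 𝓘(ℝ, F) ∞ F (fun p : N ↦ TangentSpace 𝓘(ℝ, F) p)]

variable (E F) in
/-- A smooth isometric immersion. -/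
structure IsIsometricImmersion (φ : M → N) : Prop where
  smooth : ContMDiff 𝓘(ℝ, E) 𝓘(ℝ, F) ∞ φ
  isometric : ∀ (x : M) (u v : TangentSpace 𝓘(ℝ, E) x),
    inner ℝ (mfderiv 𝓘(ℝ, E) 𝓘(ℝ, F) φ x u) (mfderiv 𝓘(ℝ, E) 𝓘(ℝ, F) φ x v) = inner ℝ u v

variable (E) in
/-- `J` maps the tangent spaces of the immersed manifold into its normal spaces. (With
`dim N = 2 dim M` this says that the immersion is Lagrangian.) -/
def IsTotallyReal (J : Π p : N, TangentSpace 𝓘(ℝ, F) p →L[ℝ] TangentSpace 𝓘(ℝ, F) p)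
    (φ : M → N) : Prop :=
  ∀ (x : M) (u v : TangentSpace 𝓘(ℝ, E) x),
    inner ℝ (J (φ x) (mfderiv 𝓘(ℝ, E) 𝓘(ℝ, F) φ x u)) (mfderiv 𝓘(ℝ, E) 𝓘(ℝ, F) φ x v) = 0

/-- The connection on `φ⁻¹TN` induced by the Levi-Civita connection of `N`. Let `e` be the
trivialization of `TN` around `φ x`, and `V̂` the section `V` read in `e`. Then
`∇̄_v V = e⁻¹ (dV̂ v) + ∇^N_{dφ v} W`, where `W = extend F (V x)` is the local vector field on `N` with
value `V x` at `φ x` that is constant in `e`. -/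
def nablaAlong (φ : M → N) (V : Π x : M, TangentSpace 𝓘(ℝ, F) (φ x)) (x : M) :
    TangentSpace 𝓘(ℝ, E) x →L[ℝ] TangentSpace 𝓘(ℝ, F) (φ x) :=
  (trivializationAt F (fun p : N ↦ TangentSpace 𝓘(ℝ, F) p) (φ x)).symmL ℝ (φ x) ∘L
      mvfderiv 𝓘(ℝ, E) (fun y ↦
        ((trivializationAt F (fun p : N ↦ TangentSpace 𝓘(ℝ, F) p) (φ x)) ⟨φ y, V y⟩).2) x
    + leviCivita F N (extend F (V x)) (φ x) ∘L mfderiv 𝓘(ℝ, E) 𝓘(ℝ, F) φ x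

variable (F) in
/-- The second fundamental form `B(v, w) = ∇̄_v (dφ W) - dφ (∇_v W)`, where `W` extends `w`. -/
def secondFundamentalForm (φ : M → N) (x : M) (v w : TangentSpace 𝓘(ℝ, E) x) :
    TangentSpace 𝓘(ℝ, F) (φ x) :=
  nablaAlong φ (fun y ↦ mfderiv 𝓘(ℝ, E) 𝓘(ℝ, F) φ y (extend E w y)) x v
    - mfderiv 𝓘(ℝ, E) 𝓘(ℝ, F) φ x (leviCivita E M (extend E w) x v)

variable (E F) in
/-- The tension field `τ(φ) = trace B`. -/
def tension (φ : M → N) (x : M) : TangentSpace 𝓘(ℝ, F) (φ x) :=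
  trace fun v w : TangentSpace 𝓘(ℝ, E) x ↦ secondFundamentalForm F φ x v w

variable (E F) in
/-- The mean curvature vector field `H = (1 / dim M) τ(φ)`. -/
def meanCurvature (φ : M → N) (x : M) : TangentSpace 𝓘(ℝ, F) (φ x) :=
  (finrank ℝ E : ℝ)⁻¹ • tension E F φ x

/-- For a connection `D` on `φ⁻¹TN` or on the normal bundle, the rough Laplacian
`-∑ i, (D_{e i} D_{e i} V - D_{∇_{e i} (e i)} V)`. -/
def roughLaplacian {φ : M → N}
    (D : (Π y : M, TangentSpace 𝓘(ℝ, F) (φ y)) →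
      Π y : M, TangentSpace 𝓘(ℝ, E) y → TangentSpace 𝓘(ℝ, F) (φ y))
    (V : Π y : M, TangentSpace 𝓘(ℝ, F) (φ y)) (x : M) : TangentSpace 𝓘(ℝ, F) (φ x) :=
  -trace fun v w : TangentSpace 𝓘(ℝ, E) x ↦
    D (fun y ↦ D V y (extend E w y)) x v - D V x (leviCivita E M (extend E w) x v)

variable (E F) in
/-- The bitension field `τ₂(φ) = Δ̄ τ(φ) - ∑ i, R^N(τ(φ), dφ (e i)) dφ (e i)`. -/
def bitension (φ : M → N) (x : M) : TangentSpace 𝓘(ℝ, F) (φ x) :=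
  roughLaplacian (fun V y (v : TangentSpace 𝓘(ℝ, E) y) ↦ nablaAlong φ V y v) (tension E F φ) x
    - trace fun v w : TangentSpace 𝓘(ℝ, E) x ↦
        curvature (tension E F φ x) (mfderiv 𝓘(ℝ, E) 𝓘(ℝ, F) φ x v)
          (mfderiv 𝓘(ℝ, E) 𝓘(ℝ, F) φ x w)

variable (E F) in
/-- A map is biharmonic if its bitension field vanishes. -/
def IsBiharmonic (φ : M → N) : Prop :=
  ∀ x : M, bitension E F φ x = 0

/-! In the following definitions `φ` is an isometric immersion. -/

variable (E) in
/-- The tangential part of `u ∈ T_{φ x}N`, as an element of `T_xM`. -/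
def tangentPart (φ : M → N) (x : M) (u : TangentSpace 𝓘(ℝ, F) (φ x)) : TangentSpace 𝓘(ℝ, E) x :=
  trace fun v w : TangentSpace 𝓘(ℝ, E) x ↦ (inner ℝ u (mfderiv 𝓘(ℝ, E) 𝓘(ℝ, F) φ x v) : ℝ) • w

variable (E) in
/-- The normal part of `u ∈ T_{φ x}N`. -/
def normalPart (φ : M → N) (x : M) (u : TangentSpace 𝓘(ℝ, F) (φ x)) :
    TangentSpace 𝓘(ℝ, F) (φ x) :=
  u - mfderiv 𝓘(ℝ, E) 𝓘(ℝ, F) φ x (tangentPart E φ x u)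

/-- The normal connection `∇^⊥_v ξ = (∇̄_v ξ)^⊥`. -/
def normalNabla (φ : M → N) (ξ : Π x : M, TangentSpace 𝓘(ℝ, F) (φ x)) (x : M)
    (v : TangentSpace 𝓘(ℝ, E) x) : TangentSpace 𝓘(ℝ, F) (φ x) :=
  normalPart E φ x (nablaAlong φ ξ x v)

/-- The shape operator: `shapeOperator φ x ξ v = A_ξ v` is the element of `T_xM` with
`⟨A_ξ v, w⟩ = ⟨B(v, w), ξ⟩` for all `w`. -/
def shapeOperator (φ : M → N) (x : M) (ξ : TangentSpace 𝓘(ℝ, F) (φ x))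
    (v : TangentSpace 𝓘(ℝ, E) x) : TangentSpace 𝓘(ℝ, E) x :=
  trace fun a b : TangentSpace 𝓘(ℝ, E) x ↦ (inner ℝ (secondFundamentalForm F φ x v a) ξ : ℝ) • b

/-- For a normal field `ξ`, the covariant derivative `(∇_u A_ξ)(v) = ∇_u (A_ξ V) - A_ξ (∇_u V)` of
the endomorphism field `A_ξ`, where `V` extends `v`. -/
def nablaShape (φ : M → N) (ξ : Π y : M, TangentSpace 𝓘(ℝ, F) (φ y)) (x : M)
    (u v : TangentSpace 𝓘(ℝ, E) x) : TangentSpace 𝓘(ℝ, E) x :=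
  leviCivita E M (fun y ↦ shapeOperator φ y (ξ y) (extend E v y)) x u
    - shapeOperator φ x (ξ x) (leviCivita E M (extend E v) x u)

variable (F) in
/-- `(∇^⊥_u B)(v, w) = ∇^⊥_u (B(V, W)) - B(∇_u V, w) - B(v, ∇_u W)`, where `V`, `W` extend `v`,
`w`. -/
def nablaB (φ : M → N) (x : M) (u v w : TangentSpace 𝓘(ℝ, E) x) : TangentSpace 𝓘(ℝ, F) (φ x) :=
  normalNabla φ (fun y ↦ secondFundamentalForm F φ y (extend E v y) (extend E w y)) x u
    - secondFundamentalForm F φ x (leviCivita E M (extend E v) x u) w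
    - secondFundamentalForm F φ x v (leviCivita E M (extend E w) x u)

end Maps

end LagrangianBiharmonic

end

/-! Since `H` is normal and `τ(φ) = m H`, the bitension field is `m` times `Δ̄H - ∑ R^N(H, e_i)e_i`.
The two equations are the tangential and the normal component of this field; they separate because
`TN = dφ(TM) ⊕ J dφ(TM)` along `φ`, by the Lagrangian condition and `dim N = 2m`.

Rough Laplacian: the Weingarten formula gives `∇̄_v H = ∇^⊥_v H - dφ(A_H v)`. Differentiating once
more, with the Weingarten formula on the first term and the Gauss formula on the second, yields the
tangential terms `∑ (∇A_H) + ∑ A_{∇^⊥ H}` and the normal terms `Δ^⊥H + ∑ B(A_H e_i, e_i)`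
(`IsIsometricImmersion.roughLaplacian_normal`).

Curvature: the curvature symmetries turn `⟨R^N(H, e_i)e_i, u⟩` into `⟨H, R^N(u, e_i)e_i⟩`, whose
value is given by the Codazzi equation (`IsIsometricImmersion.tangentPart_trace_curvature`). For the
normal component, parallelism of `J` gives `⟨R^N(H, e)e, Jz⟩ = -⟨R^N(JH, Je)Je, z⟩`. The sum of the
right-hand sides is minus the half of `Ric^N(JH, z)` belonging to the vectors `J e_i`; the other
half, over the `e_i`, is computed from the Gauss equation because `JH` is tangent
(`IsIsometricImmersion.inner_trace_curvature_map`).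

These steps rest on properties of the induced connection: it is metric, torsion free, and its
curvature is the pullback of `R^N`. Each is checked on restrictions of local fields on `N`, where
the chain rule reduces it to the Levi-Civita connection of `N`, and is then extended to all smooth
fields along `φ` by `SmoothAlong.induction`. That `J` is parallel follows from integrability and
closedness (`IsKahler.leviCivita_map`). -/

noncomputable section

namespace LagrangianBiharmonic

open Filter Topology

/-! ### Smooth vector fields along a map -/

section Regularity

variable {E : Type*} [NormedAddCommGroup E] [NormedSpace ℝ E]
  {M : Type*} [TopologicalSpace M] [ChartedSpace E M]
  {F : Type*} [NormedAddCommGroup F] [NormedSpace ℝ F]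
  {N : Type*} [TopologicalSpace N] [ChartedSpace F N] [IsManifold 𝓘(ℝ, F) ∞ N]
  {φ : M → N} {V W : Π y : M, TangentSpace 𝓘(ℝ, F) (φ y)} {f : M → ℝ} {x : M}

variable (E) in
/-- A vector field `V` along `φ` is differentiable at `x`. -/
def MDiffAlong (φ : M → N) (V : Π y : M, TangentSpace 𝓘(ℝ, F) (φ y)) (x : M) : Prop :=
  MDifferentiableAt 𝓘(ℝ, E) (𝓘(ℝ, F).prod 𝓘(ℝ, F))
    (fun y ↦ (TotalSpace.mk' F (φ y) (V y) :
      TotalSpace F (fun p : N ↦ TangentSpace 𝓘(ℝ, F) p))) x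

variable (E) in
/-- A vector field `V` along `φ` is smooth near `x`. -/
def SmoothAlong (φ : M → N) (V : Π y : M, TangentSpace 𝓘(ℝ, F) (φ y)) (x : M) : Prop :=
  ∀ᶠ z in 𝓝 x, ContMDiffAt 𝓘(ℝ, E) (𝓘(ℝ, F).prod 𝓘(ℝ, F)) ∞
    (fun y ↦ (TotalSpace.mk' F (φ y) (V y) :
      TotalSpace F (fun p : N ↦ TangentSpace 𝓘(ℝ, F) p))) z

variable (E) in
/-- A real function is smooth near `x`. -/
def SmoothFun (f : M → ℝ) (x : M) : Prop :=
  ∀ᶠ z in 𝓝 x, ContMDiffAt 𝓘(ℝ, E) 𝓘(ℝ) ∞ f z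

lemma SmoothAlong.mdiffAlong (h : SmoothAlong E φ V x) : MDiffAlong E φ V x :=
  h.self_of_nhds.mdifferentiableAt (by simp)

lemma SmoothAlong.eventually (h : SmoothAlong E φ V x) : ∀ᶠ z in 𝓝 x, SmoothAlong E φ V z :=
  eventually_eventually_nhds.2 h

lemma SmoothFun.mdifferentiableAt (h : SmoothFun E f x) : MDiffAt f x :=
  h.self_of_nhds.mdifferentiableAt (by simp)

lemma SmoothFun.eventually (h : SmoothFun E f x) : ∀ᶠ z in 𝓝 x, SmoothFun E f z :=
  eventually_eventually_nhds.2 h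

lemma SmoothFun.congr {g : M → ℝ} (h : SmoothFun E f x) (hg : g =ᶠ[𝓝 x] f) : SmoothFun E g x := by
  filter_upwards [h, hg.eventually_nhds] with z hz hz'
  exact hz.congr_of_eventuallyEq hz'

lemma SmoothFun.mul {g : M → ℝ} (h : SmoothFun E f x) (hg : SmoothFun E g x) :
    SmoothFun E (fun y ↦ f y * g y) x := by
  filter_upwards [h, hg] with z hz hz'
  exact hz.mul hz'

lemma SmoothFun.add {g : M → ℝ} (h : SmoothFun E f x) (hg : SmoothFun E g x) :
    SmoothFun E (fun y ↦ f y + g y) x := by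
  filter_upwards [h, hg] with z hz hz'
  exact hz.add hz'

lemma SmoothFun.sub {g : M → ℝ} (h : SmoothFun E f x) (hg : SmoothFun E g x) :
    SmoothFun E (fun y ↦ f y - g y) x := by
  filter_upwards [h, hg] with z hz hz'
  exact hz.sub hz'

lemma SmoothFun.const (c : ℝ) : SmoothFun E (fun _ : M ↦ c) x :=
  Eventually.of_forall fun _ ↦ contMDiffAt_const

lemma SmoothAlong.congr (h : SmoothAlong E φ V x) (hW : ∀ᶠ y in 𝓝 x, W y = V y) : SmoothAlong E φ W x := by
  filter_upwards [h, hW.eventually_nhds] with z hz hz'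
  refine hz.congr_of_eventuallyEq ?_
  filter_upwards [hz'] with y hy
  rw [hy]

lemma MDiffAlong.congr (h : MDiffAlong E φ V x) (hW : ∀ᶠ y in 𝓝 x, W y = V y) : MDiffAlong E φ W x := by
  refine MDifferentiableAt.congr_of_eventuallyEq h ?_
  filter_upwards [hW] with y hy
  rw [hy]

lemma eventually_mem_baseSet (hφ : ContinuousAt φ x) :
    ∀ᶠ y in 𝓝 x, φ y ∈ (trivializationAt F (fun p : N ↦ TangentSpace 𝓘(ℝ, F) p) (φ x)).baseSet :=
  hφ.eventually_mem ((trivializationAt F _ (φ x)).open_baseSet.mem_nhds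
    (FiberBundle.mem_baseSet_trivializationAt' _))

lemma MDiffAlong.base (h : MDiffAlong E φ V x) : MDiffAt φ x :=
  ((mdifferentiableAt_totalSpace _ _).1 h).1

lemma MDiffAlong.hat (h : MDiffAlong E φ V x) :
    MDiffAt (fun y ↦ ((trivializationAt F (fun p : N ↦ TangentSpace 𝓘(ℝ, F) p) (φ x))
      ⟨φ y, V y⟩).2) x :=
  ((mdifferentiableAt_totalSpace _ _).1 h).2

/-- The coordinates of a sum of vector fields along `φ`. -/
lemma hat_add (hφ : ContinuousAt φ x) :
    (fun y ↦ ((trivializationAt F (fun p : N ↦ TangentSpace 𝓘(ℝ, F) p) (φ x))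
      ⟨φ y, (V + W) y⟩).2) =ᶠ[𝓝 x]
    (fun y ↦ ((trivializationAt F (fun p : N ↦ TangentSpace 𝓘(ℝ, F) p) (φ x)) ⟨φ y, V y⟩).2) +
    (fun y ↦ ((trivializationAt F (fun p : N ↦ TangentSpace 𝓘(ℝ, F) p) (φ x)) ⟨φ y, W y⟩).2) := by
  filter_upwards [eventually_mem_baseSet (F := F) hφ] with y hy
  exact ((trivializationAt F (fun p : N ↦ TangentSpace 𝓘(ℝ, F) p) (φ x)).linear ℝ hy).map_add _ _

lemma hat_smul (hφ : ContinuousAt φ x) :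
    (fun y ↦ ((trivializationAt F (fun p : N ↦ TangentSpace 𝓘(ℝ, F) p) (φ x))
      ⟨φ y, (fun z ↦ f z • V z) y⟩).2) =ᶠ[𝓝 x]
    f • (fun y ↦ ((trivializationAt F (fun p : N ↦ TangentSpace 𝓘(ℝ, F) p) (φ x))
      ⟨φ y, V y⟩).2) := by
  filter_upwards [eventually_mem_baseSet (F := F) hφ] with y hy
  exact ((trivializationAt F (fun p : N ↦ TangentSpace 𝓘(ℝ, F) p) (φ x)).linear ℝ hy).map_smul _ _

lemma MDiffAlong.add (hV : MDiffAlong E φ V x) (hW : MDiffAlong E φ W x) :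
    MDiffAlong E φ (V + W) x :=
  (mdifferentiableAt_totalSpace _ _).2 ⟨hV.base,
    (hV.hat.add hW.hat).congr_of_eventuallyEq (hat_add hV.base.continuousAt)⟩

lemma MDiffAlong.smul (hf : MDiffAt f x) (hV : MDiffAlong E φ V x) :
    MDiffAlong E φ (fun y ↦ f y • V y) x :=
  (mdifferentiableAt_totalSpace _ _).2 ⟨hV.base,
    (hf.smul hV.hat).congr_of_eventuallyEq (hat_smul hV.base.continuousAt)⟩

lemma SmoothAlong.add (hV : SmoothAlong E φ V x) (hW : SmoothAlong E φ W x) :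
    SmoothAlong E φ (V + W) x := by
  filter_upwards [hV, hW] with z hz hz'
  rw [contMDiffAt_totalSpace] at hz hz' ⊢
  exact ⟨hz.1, (hz.2.add hz'.2).congr_of_eventuallyEq (hat_add hz.1.continuousAt)⟩

lemma SmoothAlong.smul (hf : SmoothFun E f x) (hV : SmoothAlong E φ V x) :
    SmoothAlong E φ (fun y ↦ f y • V y) x := by
  filter_upwards [hV, hf] with z hz hz'
  rw [contMDiffAt_totalSpace] at hz ⊢
  exact ⟨hz.1, (hz'.smul hz.2).congr_of_eventuallyEq (hat_smul hz.1.continuousAt)⟩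

lemma SmoothAlong.const_smul (c : ℝ) (hV : SmoothAlong E φ V x) :
    SmoothAlong E φ (fun y ↦ c • V y) x :=
  SmoothAlong.smul (.const c) hV

lemma SmoothAlong.neg (hV : SmoothAlong E φ V x) : SmoothAlong E φ (-V) x :=
  (hV.const_smul (-1)).congr (Eventually.of_forall fun y ↦ by simp)

lemma SmoothAlong.sub (hV : SmoothAlong E φ V x) (hW : SmoothAlong E φ W x) :
    SmoothAlong E φ (V - W) x :=
  (hV.add hW.neg).congr (Eventually.of_forall fun y ↦ by simp [sub_eq_add_neg])

lemma SmoothAlong.sum {ι : Type*} (s : Finset ι) {U : ι → Π y : M, TangentSpace 𝓘(ℝ, F) (φ y)}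
    (hφ : ContMDiff 𝓘(ℝ, E) 𝓘(ℝ, F) ∞ φ) (hU : ∀ i ∈ s, SmoothAlong E φ (U i) x) :
    SmoothAlong E φ (fun y ↦ ∑ i ∈ s, U i y) x := by
  classical
  induction s using Finset.induction_on with
  | empty =>
    refine Eventually.of_forall fun z ↦ ?_
    have h := (contMDiff_zeroSection ℝ (fun p : N ↦ TangentSpace 𝓘(ℝ, F) p) (n := ∞)
      (IB := 𝓘(ℝ, F)) (F := F)).comp hφ
    simpa [zeroSection, Function.comp_def] using h z
  | insert a s ha ih =>
    simp only [Finset.mem_insert, forall_eq_or_imp] at hU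
    refine (hU.1.add (ih hU.2)).congr (Eventually.of_forall fun y ↦ ?_)
    simp [Finset.sum_insert ha]

/-- A vector field on `N` that is smooth near `φ x` restricts to a smooth field along `φ`. -/
lemma SmoothAlong.comp {X : Π p : N, TangentSpace 𝓘(ℝ, F) p}
    (hX : SmoothAlong F (fun p : N ↦ p) X (φ x)) (hφ : ContMDiff 𝓘(ℝ, E) 𝓘(ℝ, F) ∞ φ) :
    SmoothAlong E φ (fun y ↦ X (φ y)) x := by
  filter_upwards [hφ.continuous.continuousAt.eventually hX] with z hz
  exact ContMDiffAt.comp z hz (hφ z)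

omit [IsManifold 𝓘(ℝ, F) ∞ N] in
lemma SmoothFun.comp {g : N → ℝ} (hg : SmoothFun F g (φ x))
    (hφ : ContMDiff 𝓘(ℝ, E) 𝓘(ℝ, F) ∞ φ) : SmoothFun E (fun y ↦ g (φ y)) x := by
  filter_upwards [hφ.continuous.continuousAt.eventually hg] with z hz
  exact ContMDiffAt.comp z hz (hφ z)

lemma smoothAlong_extend {p : N} (w : TangentSpace 𝓘(ℝ, F) p) :
    SmoothAlong F (fun q : N ↦ q) (extend F w) p := by
  obtain ⟨s, hs, h⟩ := FiberBundle.exists_contMDiffOn_extend (k := ∞) 𝓘(ℝ, F) F w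
  filter_upwards [eventually_mem_nhds_iff.2 hs] with z hz
  exact h.contMDiffAt hz

/-- The extension is constant in the trivialization at `p`, so near `p` it is a linear function of
`w`, on one neighbourhood for all `w`. Linearity in the extended vectors of everything defined
through `extend` comes from here. -/
lemma eventually_extend_eq {p : N} :
    ∀ᶠ q in 𝓝 p, ∀ w : TangentSpace 𝓘(ℝ, F) p, extend F w q =
      (trivializationAt F (fun q : N ↦ TangentSpace 𝓘(ℝ, F) q) p).symmₗ ℝ q
        ((trivializationAt F (fun q : N ↦ TangentSpace 𝓘(ℝ, F) q) p).linearMapAt ℝ p w) := by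
  filter_upwards [eventually_mem_baseSet (F := F) (φ := fun q : N ↦ q) continuousAt_id] with q hq w
  rw [Trivialization.linearMapAt_apply, if_pos (FiberBundle.mem_baseSet_trivializationAt F _ p),
    Trivialization.symmₗ_apply _ hq]
  rfl

lemma extend_add {p : N} (v w : TangentSpace 𝓘(ℝ, F) p) :
    ∀ᶠ q in 𝓝 p, extend F (v + w) q = (extend F v + extend F w) q := by
  filter_upwards [eventually_extend_eq (F := F) (p := p)] with q hq
  simp only [hq, Pi.add_apply, map_add]

lemma extend_smul {p : N} (c : ℝ) (w : TangentSpace 𝓘(ℝ, F) p) :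
    ∀ᶠ q in 𝓝 p, extend F (c • w) q = c • extend F w q := by
  filter_upwards [eventually_extend_eq (F := F) (p := p)] with q hq
  simp only [hq, map_smul]

omit [IsManifold 𝓘(ℝ, F) ∞ N] in
lemma mvfderiv_comp_map {G : Type*} [NormedAddCommGroup G] [NormedSpace ℝ G]
    {g : N → G} (hg : MDiffAt g (φ x)) (hφ : MDiffAt φ x)
    (v : TangentSpace 𝓘(ℝ, E) x) :
    mvfderiv 𝓘(ℝ, E) (fun y ↦ g (φ y)) x v =
      mvfderiv 𝓘(ℝ, F) g (φ x) (mfderiv 𝓘(ℝ, E) 𝓘(ℝ, F) φ x v) :=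
  mfderiv_comp_apply x hg hφ v

lemma mvfderiv_congr {f g : M → F} (h : f =ᶠ[𝓝 x] g) :
    mvfderiv 𝓘(ℝ, E) f x = mvfderiv 𝓘(ℝ, E) g x := by
  ext v
  simp only [mvfderiv, ContinuousLinearMap.comp_apply]
  have := h.mfderiv_eq (I := 𝓘(ℝ, E)) (I' := 𝓘(ℝ, F))
  exact congrArg (fun L : E →L[ℝ] F ↦ L v) this

/-- A property of vector fields along `φ` holds for all fields smooth near `x` if it is local,
compatible with sums and with products by smooth functions, and holds for the restrictions of
the local fields on `N` that are constant in the trivialization at `φ x`. -/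
lemma SmoothAlong.induction [FiniteDimensional ℝ F]
    {P : (Π y : M, TangentSpace 𝓘(ℝ, F) (φ y)) → Prop}
    (hφ : ContMDiff 𝓘(ℝ, E) 𝓘(ℝ, F) ∞ φ)
    (congr : ∀ V W, SmoothAlong E φ V x → (∀ᶠ y in 𝓝 x, W y = V y) → P V → P W)
    (add : ∀ V W, SmoothAlong E φ V x → SmoothAlong E φ W x → P V → P W → P (V + W))
    (smul : ∀ (f : M → ℝ) V, SmoothFun E f x → SmoothAlong E φ V x → P V → P (fun y ↦ f y • V y))
    (base : ∀ w : TangentSpace 𝓘(ℝ, F) (φ x), P (fun y ↦ extend F w (φ y)))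
    (hV : SmoothAlong E φ V x) : P V := by
  classical
  let t := trivializationAt F (fun p : N ↦ TangentSpace 𝓘(ℝ, F) p) (φ x)
  have ht : φ x ∈ t.baseSet := FiberBundle.mem_baseSet_trivializationAt F _ (φ x)
  let b := Module.finBasis ℝ F
  -- Near `x` the field is `∑ c i • U i`, with `c i` its coordinates in the trivialization at `φ x`
  -- and `U i` the restriction of the constant field given by the `i`-th basis vector of `F`.
  let c (i) (y : M) : ℝ := b.repr ((t ⟨φ y, V y⟩).2) i
  let U (i) (y : M) : TangentSpace 𝓘(ℝ, F) (φ y) := extend F (t.symm (φ x) (b i)) (φ y)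
  have hU (i) : SmoothAlong E φ (U i) x := (smoothAlong_extend _).comp hφ
  have hc (i) : SmoothFun E (c i) x := by
    have hmem := eventually_mem_baseSet (F := F) hφ.continuous.continuousAt (x := x)
    filter_upwards [hV, hmem] with z hz hzt
    have h1 : ContMDiffAt 𝓘(ℝ, E) 𝓘(ℝ, F) ∞ (fun y ↦ (t ⟨φ y, V y⟩).2) z :=
      ((t.contMDiffAt_iff ((t.mem_source).2 hzt)).1 hz).2
    exact ContMDiffAt.comp z
      (((LinearMap.toContinuousLinearMap (b.coord i)).contMDiff).contMDiffAt) h1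
  have hsum (s : Finset _) : SmoothAlong E φ (fun y ↦ ∑ i ∈ s, c i y • U i y) x ∧
      P (fun y ↦ ∑ i ∈ s, c i y • U i y) := by
    refine ⟨.sum s hφ fun i _ ↦ (hU i).smul (hc i), ?_⟩
    induction s using Finset.induction_on with
    | empty =>
      -- The zero field is not among the given cases; it is obtained as the function `0` times the
      -- restriction of an extension.
      refine congr _ _ (((smoothAlong_extend (F := F) (0 : TangentSpace 𝓘(ℝ, F) (φ x))).comp hφ).smul
        (.const 0)) ?_ (smul (fun _ ↦ 0) _ (.const 0) ((smoothAlong_extend _).comp hφ) (base 0))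
      exact Eventually.of_forall fun y ↦ by simp
    | insert a s ha ih =>
      have := add _ _ ((hU a).smul (hc a)) (.sum s hφ fun i _ ↦ (hU i).smul (hc i))
        (smul _ _ (hc a) (hU a) (base _)) ih
      convert this using 1
      funext y
      simp [Finset.sum_insert ha]
  refine congr _ _ (hsum Finset.univ).1 ?_ (hsum Finset.univ).2
  filter_upwards [eventually_mem_baseSet (F := F) hφ.continuous.continuousAt (x := x)] with y hy
  have h1 : ∀ i, U i y = t.symmₗ ℝ (φ y) (b i) := fun i ↦ by
    simp only [U, extend]
    erw [t.apply_mk_symm ht]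
    rw [t.symmₗ_apply hy]
  have h2 : V y = t.symmₗ ℝ (φ y) ((t ⟨φ y, V y⟩).2) := by
    rw [t.symmₗ_apply hy]
    exact (t.symm_apply_apply_mk hy _).symm
  rw [h2]
  conv_lhs => rw [← b.sum_repr ((t ⟨φ y, V y⟩).2)]
  simp only [map_sum, map_smul, h1, c]

end Regularity

/-! ### The induced connection: Leibniz rule and restriction of fields on `N` -/

section InducedConnection

set_option linter.unusedSectionVars false

variable {E : Type*} [NormedAddCommGroup E] [NormedSpace ℝ E]
  {M : Type*} [TopologicalSpace M] [ChartedSpace E M]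
  {F : Type*} [NormedAddCommGroup F] [NormedSpace ℝ F] [FiniteDimensional ℝ F]
  {N : Type*} [TopologicalSpace N] [ChartedSpace F N] [IsManifold 𝓘(ℝ, F) ∞ N]
  [RiemannianBundle (fun p : N ↦ TangentSpace 𝓘(ℝ, F) p)]
  [IsContMDiffRiemannianBundle 𝓘(ℝ, F) ∞ F (fun p : N ↦ TangentSpace 𝓘(ℝ, F) p)]
  {φ : M → N} {V W : Π y : M, TangentSpace 𝓘(ℝ, F) (φ y)} {f : M → ℝ} {x : M}
  {X Y : Π p : N, TangentSpace 𝓘(ℝ, F) p} {p : N}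

lemma leviCivita_congr (hX : MDiffAlong F (fun q : N ↦ q) X p) (h : ∀ᶠ q in 𝓝 p, Y q = X q) :
    leviCivita F N Y p = leviCivita F N X p :=
  (leviCivita F N).isCovariantDerivativeOn.congr_of_eventuallyEq (s := Set.univ)
    (MDiffAlong.congr hX h) hX univ_mem h

lemma leviCivita_add (hX : MDiffAlong F (fun q : N ↦ q) X p)
    (hY : MDiffAlong F (fun q : N ↦ q) Y p) :
    leviCivita F N (X + Y) p = leviCivita F N X p + leviCivita F N Y p :=
  (leviCivita F N).isCovariantDerivativeOn.add (s := Set.univ) hX hY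

lemma leviCivita_smul {g : N → ℝ} (hg : MDiffAt g p) (hX : MDiffAlong F (fun q : N ↦ q) X p)
    (v : TangentSpace 𝓘(ℝ, F) p) :
    leviCivita F N (fun q ↦ g q • X q) p v =
      mvfderiv 𝓘(ℝ, F) g p v • X p + g p • leviCivita F N X p v := by
  have h := (leviCivita F N).isCovariantDerivativeOn.leibniz (s := Set.univ) hX hg
  change leviCivita F N (g • X) p v = _
  rw [h]
  simp [add_comm]

lemma mdiffAlong_extend (w : TangentSpace 𝓘(ℝ, F) p) :
    MDiffAlong F (fun q : N ↦ q) (extend F w) p :=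
  (smoothAlong_extend w).mdiffAlong

lemma leviCivita_extend_add (v w : TangentSpace 𝓘(ℝ, F) p) :
    leviCivita F N (extend F (v + w)) p =
      leviCivita F N (extend F v) p + leviCivita F N (extend F w) p := by
  rw [← leviCivita_add (mdiffAlong_extend v) (mdiffAlong_extend w)]
  exact leviCivita_congr ((mdiffAlong_extend v).add (mdiffAlong_extend w)) (extend_add v w)

lemma leviCivita_extend_smul (c : ℝ) (w : TangentSpace 𝓘(ℝ, F) p) :
    leviCivita F N (extend F (c • w)) p = c • leviCivita F N (extend F w) p := by
  ext u
  have := leviCivita_smul (g := fun _ ↦ c) mdifferentiableAt_const (mdiffAlong_extend w) u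
  rw [mvfderiv_const] at this
  rw [leviCivita_congr ((mdiffAlong_extend w).smul (f := fun _ ↦ c) mdifferentiableAt_const)
    (extend_smul c w)]
  simpa using this

lemma nablaAlong_congr (h : ∀ᶠ y in 𝓝 x, W y = V y) :
    nablaAlong (E := E) φ W x = nablaAlong φ V x := by
  unfold nablaAlong
  rw [h.self_of_nhds, mvfderiv_congr (g := fun y ↦
    ((trivializationAt F (fun p : N ↦ TangentSpace 𝓘(ℝ, F) p) (φ x)) ⟨φ y, V y⟩).2)]
  filter_upwards [h] with y hy
  rw [hy]

lemma nablaAlong_add (hV : MDiffAlong E φ V x) (hW : MDiffAlong E φ W x) :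
    nablaAlong (E := E) φ (V + W) x = nablaAlong φ V x + nablaAlong φ W x := by
  unfold nablaAlong
  rw [mvfderiv_congr (hat_add hV.base.continuousAt), mvfderiv_add hV.hat hW.hat, Pi.add_apply,
    leviCivita_extend_add, ContinuousLinearMap.comp_add, ContinuousLinearMap.add_comp]
  abel

lemma nablaAlong_smul (hf : MDiffAt f x) (hV : MDiffAlong E φ V x)
    (v : TangentSpace 𝓘(ℝ, E) x) :
    nablaAlong φ (fun y ↦ f y • V y) x v =
      mvfderiv 𝓘(ℝ, E) f x v • V x + f x • nablaAlong φ V x v := by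
  unfold nablaAlong
  have hx : φ x ∈ (trivializationAt F (fun p : N ↦ TangentSpace 𝓘(ℝ, F) p) (φ x)).baseSet :=
    FiberBundle.mem_baseSet_trivializationAt F _ (φ x)
  -- The derivative of `f` multiplies the coordinates of `V` at `x`; carried back to the fibre they
  -- give `V x`.
  have h : (trivializationAt F (fun p : N ↦ TangentSpace 𝓘(ℝ, F) p) (φ x)).symmL ℝ (φ x)
      ((trivializationAt F (fun p : N ↦ TangentSpace 𝓘(ℝ, F) p) (φ x)) ⟨φ x, V x⟩).2 = V x := by
    rw [Trivialization.symmL_apply _ hx]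
    exact Trivialization.symm_apply_apply_mk _ hx _
  rw [mvfderiv_congr (hat_smul hV.base.continuousAt), mvfderiv_smul hf hV.hat,
    leviCivita_extend_smul]
  simp only [_root_.add_apply, ContinuousLinearMap.comp_apply,
    _root_.smul_apply, ContinuousLinearMap.smulRight_apply, map_add, map_smul, h,
    smul_add]
  abel

/-- The coordinates of the extension are constant near `p`, so the derivative term of `nablaAlong`
vanishes. -/
lemma nablaAlong_id_extend (w : TangentSpace 𝓘(ℝ, F) p) :
    nablaAlong (fun q : N ↦ q) (extend F w) p = leviCivita F N (extend F w) p := by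
  have hc : mvfderiv 𝓘(ℝ, F) (fun q ↦ ((trivializationAt F
      (fun p : N ↦ TangentSpace 𝓘(ℝ, F) p) p) ⟨q, extend F w q⟩).2) p = 0 := by
    rw [mvfderiv_congr (g := fun _ ↦ ((trivializationAt F
      (fun p : N ↦ TangentSpace 𝓘(ℝ, F) p) p) ⟨p, w⟩).2), mvfderiv_const]
    filter_upwards [eventually_mem_baseSet (F := F) (φ := fun q : N ↦ q) (x := p)
      continuousAt_id] with q hq
    have := congrArg Prod.snd (Trivialization.apply_mk_symm _ hq ((trivializationAt F
      (fun p : N ↦ TangentSpace 𝓘(ℝ, F) p) p) ⟨p, w⟩).2)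
    exact this
  unfold nablaAlong
  rw [hc, FiberBundle.extend_apply_self, ContinuousLinearMap.comp_zero, zero_add]
  ext v
  rw [ContinuousLinearMap.comp_apply, show mfderiv 𝓘(ℝ, F) 𝓘(ℝ, F) (fun q : N ↦ q) p =
    ContinuousLinearMap.id ℝ _ from mfderiv_id]
  rfl

/-- The connection induced by the identity map is the Levi-Civita connection. -/
lemma nablaAlong_id (hX : MDiffAlong F (fun q : N ↦ q) X p) :
    nablaAlong (fun q : N ↦ q) X p = leviCivita F N X p := by
  -- The difference of two connections is tensorial, so its value on `X` depends on `X p` only; it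
  -- may be tested on the extension of `X p`, where it is zero.
  let Φ (Y : Π p : N, TangentSpace 𝓘(ℝ, F) p) :
      TangentSpace 𝓘(ℝ, F) p →L[ℝ] TangentSpace 𝓘(ℝ, F) p :=
    nablaAlong (fun q : N ↦ q) Y p - leviCivita F N Y p
  have hΦ : TensorialAt 𝓘(ℝ, F) F Φ p := by
    constructor
    · intro g Y hg hY
      ext u
      have h1 : nablaAlong (fun q : N ↦ q) (g • Y) p u =
        mvfderiv 𝓘(ℝ, F) g p u • Y p + g p • nablaAlong (fun q : N ↦ q) Y p u :=
        nablaAlong_smul (φ := fun q : N ↦ q) hg hY u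
      have h2 : leviCivita F N (g • Y) p u =
        mvfderiv 𝓘(ℝ, F) g p u • Y p + g p • leviCivita F N Y p u := leviCivita_smul hg hY u
      simp only [Φ, _root_.sub_apply, _root_.smul_apply, h1, h2, smul_sub]
      abel
    · intro Y Z hY hZ
      have h1 : nablaAlong (fun q : N ↦ q) (Y + Z) p =
        nablaAlong (fun q : N ↦ q) Y p + nablaAlong (fun q : N ↦ q) Z p :=
        nablaAlong_add (φ := fun q : N ↦ q) hY hZ
      simp only [Φ]
      rw [h1, leviCivita_add hY hZ]
      abel
  have hp := hΦ.pointwise hX (mdiffAlong_extend (X p)) (by simp)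
  simp only [Φ, nablaAlong_id_extend, sub_self] at hp
  exact sub_eq_zero.1 hp

/-- The induced connection on the restriction to `φ` of a vector field on `N`. -/
lemma nablaAlong_comp (hX : MDiffAlong F (fun q : N ↦ q) X (φ x)) (hφ : MDiffAt φ x)
    (v : TangentSpace 𝓘(ℝ, E) x) :
    nablaAlong φ (fun y ↦ X (φ y)) x v =
      leviCivita F N X (φ x) (mfderiv 𝓘(ℝ, E) 𝓘(ℝ, F) φ x v) := by
  rw [← nablaAlong_id hX]
  have hchain := mvfderiv_comp_map (MDiffAlong.hat hX) hφ v
  have hid : mfderiv 𝓘(ℝ, F) 𝓘(ℝ, F) (fun q : N ↦ q) (φ x) = ContinuousLinearMap.id ℝ _ :=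
    mfderiv_id
  unfold nablaAlong
  rw [_root_.add_apply, _root_.add_apply, ContinuousLinearMap.comp_apply,
    ContinuousLinearMap.comp_apply, ContinuousLinearMap.comp_apply,
    ContinuousLinearMap.comp_apply, hid]
  congr 1
  exact congrArg _ hchain

end InducedConnection

/-! ### Differentials of maps and Lie brackets as commutators -/

section Differentials

set_option linter.unusedSectionVars false

variable {E : Type*} [NormedAddCommGroup E] [NormedSpace ℝ E]
  {M : Type*} [TopologicalSpace M] [ChartedSpace E M] [IsManifold 𝓘(ℝ, E) ∞ M]
  {F : Type*} [NormedAddCommGroup F] [NormedSpace ℝ F]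
  {N : Type*} [TopologicalSpace N] [ChartedSpace F N] [IsManifold 𝓘(ℝ, F) ∞ N]
  {x : M} {X Y : Π y : M, TangentSpace 𝓘(ℝ, E) y} {f : M → ℝ}

/-- The field is the composite of `X` with the tangent map. Smoothness of `φ` is assumed near `x`
only, so that the lemma also applies to local functions; hence the tangent map within an open set.
-/
lemma eventually_contMDiffAt_mfderiv {φ : M → N}
    (hφ : ∀ᶠ z in 𝓝 x, ContMDiffAt 𝓘(ℝ, E) 𝓘(ℝ, F) ∞ φ z)
    (hX : SmoothAlong E (fun y : M ↦ y) X x) :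
    SmoothAlong E φ (fun y ↦ mfderiv 𝓘(ℝ, E) 𝓘(ℝ, F) φ y (X y)) x := by
  obtain ⟨u, hu, huo, hxu⟩ := eventually_nhds_iff.1 (hφ.and hX)
  have hφu : ContMDiffOn 𝓘(ℝ, E) 𝓘(ℝ, F) ∞ φ u := fun z hz ↦ (hu z hz).1.contMDiffWithinAt
  have hT := hφu.contMDiffOn_tangentMapWithin (m := ∞) (by simp) huo.uniqueMDiffOn
  filter_upwards [huo.mem_nhds hxu] with z hz
  have hT' := (hT ⟨z, X z⟩ hz).contMDiffAt
    ((huo.preimage (FiberBundle.continuous_proj E _)).mem_nhds hz)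
  have := ContMDiffAt.comp z hT' (hu z hz).2
  refine this.congr_of_eventuallyEq ?_
  filter_upwards [huo.mem_nhds hz] with y hy
  simp only [Function.comp_apply, tangentMapWithin, mfderivWithin_of_isOpen huo hy]

lemma SmoothFun.derivative (hf : SmoothFun E f x) (hX : SmoothAlong E (fun y : M ↦ y) X x) :
    SmoothFun E (fun y ↦ mvfderiv 𝓘(ℝ, E) f y (X y)) x := by
  filter_upwards [eventually_contMDiffAt_mfderiv hf hX] with z hz
  rw [contMDiffAt_totalSpace] at hz
  refine hz.2.congr_of_eventuallyEq (Eventually.of_forall fun y ↦ ?_)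
  simp
  rfl

variable [FiniteDimensional ℝ E]

lemma SmoothAlong.mlieBracket (hX : SmoothAlong E (fun y : M ↦ y) X x)
    (hY : SmoothAlong E (fun y : M ↦ y) Y x) :
    SmoothAlong E (fun y : M ↦ y) (VectorField.mlieBracket 𝓘(ℝ, E) X Y) x := by
  have : IsManifold 𝓘(ℝ, E) (minSmoothness ℝ 2) M := by
    simp only [minSmoothness_of_isRCLikeNormedField]
    infer_instance
  have : IsManifold 𝓘(ℝ, E) (((⊤ : ℕ∞) : WithTop ℕ∞) + 1) M := by
    simpa using (inferInstance : IsManifold 𝓘(ℝ, E) ∞ M)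
  filter_upwards [hX, hY] with z hz hz'
  exact ContMDiffAt.mlieBracket_vectorField (n := ⊤) (m := ⊤) hz hz' (by simp)

lemma mlieBracket_leibniz {Z : Π y : M, TangentSpace 𝓘(ℝ, E) y}
    (hX : SmoothAlong E (fun y : M ↦ y) X x) (hY : SmoothAlong E (fun y : M ↦ y) Y x)
    (hZ : SmoothAlong E (fun y : M ↦ y) Z x) :
    VectorField.mlieBracket 𝓘(ℝ, E) X (VectorField.mlieBracket 𝓘(ℝ, E) Y Z) x =
      VectorField.mlieBracket 𝓘(ℝ, E) (VectorField.mlieBracket 𝓘(ℝ, E) X Y) Z x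
      + VectorField.mlieBracket 𝓘(ℝ, E) Y (VectorField.mlieBracket 𝓘(ℝ, E) X Z) x := by
  have two {Z : Π y : M, TangentSpace 𝓘(ℝ, E) y} (hZ : SmoothAlong E (fun y : M ↦ y) Z x) :
      CMDiffAt (minSmoothness ℝ 2) (T% Z) x := by
    refine ContMDiffAt.of_le hZ.self_of_nhds ?_
    simp only [minSmoothness_of_isRCLikeNormedField]
    exact ENat.LEInfty.out
  have : IsManifold 𝓘(ℝ, E) (minSmoothness ℝ 3) M := by
    simp only [minSmoothness_of_isRCLikeNormedField]
    infer_instance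
  exact VectorField.leibniz_identity_mlieBracket_apply (two hX) (two hY) (two hZ)

lemma mlieBracket_jacobi {Z : Π y : M, TangentSpace 𝓘(ℝ, E) y}
    (hX : SmoothAlong E (fun y : M ↦ y) X x) (hY : SmoothAlong E (fun y : M ↦ y) Y x)
    (hZ : SmoothAlong E (fun y : M ↦ y) Z x) :
    VectorField.mlieBracket 𝓘(ℝ, E) X (VectorField.mlieBracket 𝓘(ℝ, E) Y Z) x
      + VectorField.mlieBracket 𝓘(ℝ, E) Y (VectorField.mlieBracket 𝓘(ℝ, E) Z X) x
      + VectorField.mlieBracket 𝓘(ℝ, E) Z (VectorField.mlieBracket 𝓘(ℝ, E) X Y) x = 0 := by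
  have h := mlieBracket_leibniz hX hY hZ
  rw [VectorField.mlieBracket_swap_apply (V := VectorField.mlieBracket 𝓘(ℝ, E) X Y),
    VectorField.mlieBracket_swap (V := X) (W := Z),
    show -VectorField.mlieBracket 𝓘(ℝ, E) Z X = (-1 : ℝ) • VectorField.mlieBracket 𝓘(ℝ, E) Z X by
      rw [neg_one_smul],
    VectorField.mlieBracket_const_smul_right (hZ.mlieBracket hX).mdiffAlong] at h
  rw [h]
  module

/-- The Lie bracket acts on functions as the commutator of derivations. -/
lemma mvfderiv_mlieBracket (hX : SmoothAlong E (fun y : M ↦ y) X x)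
    (hY : SmoothAlong E (fun y : M ↦ y) Y x) (hf : SmoothFun E f x) :
    mvfderiv 𝓘(ℝ, E) f x (VectorField.mlieBracket 𝓘(ℝ, E) X Y x) =
      mvfderiv 𝓘(ℝ, E) (fun y ↦ mvfderiv 𝓘(ℝ, E) f y (Y y)) x (X x)
        - mvfderiv 𝓘(ℝ, E) (fun y ↦ mvfderiv 𝓘(ℝ, E) f y (X y)) x (Y x) := by
  -- The formula is read off from the Jacobi identity for `X`, `Y`, `f • W`: after subtracting `f`
  -- times the identity for `X`, `Y`, `W`, only multiples of `W x` survive, and their coefficients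
  -- can be compared once `W x ≠ 0`. This needs a nonzero vector, so dimension zero is treated
  -- apart.
  rcases subsingleton_or_nontrivial E with hE | hE
  · have h (v : TangentSpace 𝓘(ℝ, E) x) : v = 0 := Subsingleton.elim (α := E) _ _
    rw [h (VectorField.mlieBracket 𝓘(ℝ, E) X Y x), h (X x), h (Y x)]
    simp
  obtain ⟨w, hw⟩ : ∃ w : TangentSpace 𝓘(ℝ, E) x, w ≠ 0 := exists_ne (0 : E)
  let W : Π y : M, TangentSpace 𝓘(ℝ, E) y := extend E w
  have hWx : W x = w := FiberBundle.extend_apply_self E w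
  have hW : SmoothAlong E (fun y : M ↦ y) W x := smoothAlong_extend _
  have key (Z Z' : Π y : M, TangentSpace 𝓘(ℝ, E) y) {g : M → ℝ} {y : M} (hg : SmoothFun E g y)
      (hZ' : SmoothAlong E (fun y : M ↦ y) Z' y) :
      VectorField.mlieBracket 𝓘(ℝ, E) Z (g • Z') y =
        mvfderiv 𝓘(ℝ, E) g y (Z y) • Z' y + g y • VectorField.mlieBracket 𝓘(ℝ, E) Z Z' y :=
    VectorField.mlieBracket_smul_right hg.mdifferentiableAt hZ'.mdiffAlong
  have key2 (Z Z' : Π y : M, TangentSpace 𝓘(ℝ, E) y)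
      (hZ : SmoothAlong E (fun y : M ↦ y) Z x) (hZ' : SmoothAlong E (fun y : M ↦ y) Z' x) :
      VectorField.mlieBracket 𝓘(ℝ, E) Z (VectorField.mlieBracket 𝓘(ℝ, E) Z' (f • W)) x =
        mvfderiv 𝓘(ℝ, E) (fun y ↦ mvfderiv 𝓘(ℝ, E) f y (Z' y)) x (Z x) • W x
        + mvfderiv 𝓘(ℝ, E) f x (Z' x) • VectorField.mlieBracket 𝓘(ℝ, E) Z W x
        + (mvfderiv 𝓘(ℝ, E) f x (Z x) • VectorField.mlieBracket 𝓘(ℝ, E) Z' W x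
        + f x • VectorField.mlieBracket 𝓘(ℝ, E) Z
            (VectorField.mlieBracket 𝓘(ℝ, E) Z' W) x) := by
    have h1 : VectorField.mlieBracket 𝓘(ℝ, E) Z (VectorField.mlieBracket 𝓘(ℝ, E) Z' (f • W)) x =
        VectorField.mlieBracket 𝓘(ℝ, E) Z
          ((fun y ↦ mvfderiv 𝓘(ℝ, E) f y (Z' y)) • W
            + f • VectorField.mlieBracket 𝓘(ℝ, E) Z' W) x := by
      refine Filter.EventuallyEq.mlieBracket_vectorField_eq EventuallyEq.rfl ?_
      filter_upwards [hf.eventually, hW.eventually] with y hfy hWy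
      exact key Z' W hfy hWy
    have hs1 : SmoothAlong E (fun y : M ↦ y) ((fun y ↦ mvfderiv 𝓘(ℝ, E) f y (Z' y)) • W) x :=
      hW.smul (hf.derivative hZ')
    have hs2 : SmoothAlong E (fun y : M ↦ y) (f • VectorField.mlieBracket 𝓘(ℝ, E) Z' W) x :=
      (hZ'.mlieBracket hW).smul hf
    rw [h1, VectorField.mlieBracket_add_right hs1.mdiffAlong hs2.mdiffAlong,
      key _ _ (hf.derivative hZ') hW, key _ _ hf (hZ'.mlieBracket hW)]
  have hfW : SmoothAlong E (fun y : M ↦ y) (f • W) x := hW.smul hf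
  have jac1 := mlieBracket_leibniz hX hY hfW
  have jac2 := mlieBracket_leibniz hX hY hW
  rw [key2 X Y hX hY, key2 Y X hY hX, key _ _ hf hW, jac2] at jac1
  have h0 : (mvfderiv 𝓘(ℝ, E) f x (VectorField.mlieBracket 𝓘(ℝ, E) X Y x)
      - (mvfderiv 𝓘(ℝ, E) (fun y ↦ mvfderiv 𝓘(ℝ, E) f y (Y y)) x (X x)
        - mvfderiv 𝓘(ℝ, E) (fun y ↦ mvfderiv 𝓘(ℝ, E) f y (X y)) x (Y x))) • W x = 0 := by
    rw [sub_smul, sub_smul]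
    rw [← sub_eq_zero] at jac1
    rw [← neg_eq_zero, ← jac1]
    module
  rw [hWx, smul_eq_zero, or_iff_left hw] at h0
  exact sub_eq_zero.1 h0

end Differentials

/-! ### Metric compatibility of the induced connection -/

section MetricTorsion

set_option linter.unusedSectionVars false

variable {E : Type*} [NormedAddCommGroup E] [NormedSpace ℝ E]
  {M : Type*} [TopologicalSpace M] [ChartedSpace E M]
  {F : Type*} [NormedAddCommGroup F] [NormedSpace ℝ F] [FiniteDimensional ℝ F]
  {N : Type*} [TopologicalSpace N] [ChartedSpace F N] [IsManifold 𝓘(ℝ, F) ∞ N]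
  [RiemannianBundle (fun p : N ↦ TangentSpace 𝓘(ℝ, F) p)]
  [IsContMDiffRiemannianBundle 𝓘(ℝ, F) ∞ F (fun p : N ↦ TangentSpace 𝓘(ℝ, F) p)]
  {φ : M → N} {V W : Π y : M, TangentSpace 𝓘(ℝ, F) (φ y)} {f : M → ℝ} {x : M}

lemma MDiffAlong.inner_fun (hV : MDiffAlong E φ V x) (hW : MDiffAlong E φ W x) :
    MDiffAt (fun y ↦ inner ℝ (V y) (W y)) x :=
  MDifferentiableAt.inner_bundle (IB := 𝓘(ℝ, F)) (F := F)
    (E := fun p : N ↦ TangentSpace 𝓘(ℝ, F) p) (b := φ) hV hW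

lemma SmoothAlong.inner_fun (hV : SmoothAlong E φ V x) (hW : SmoothAlong E φ W x) :
    SmoothFun E (fun y ↦ inner ℝ (V y) (W y)) x := by
  filter_upwards [hV, hW] with z hz hz'
  exact ContMDiffAt.inner_bundle (IB := 𝓘(ℝ, F)) (F := F)
    (E := fun p : N ↦ TangentSpace 𝓘(ℝ, F) p) (b := φ) hz hz'

lemma nablaAlong_neg (hV : MDiffAlong E φ V x) :
    nablaAlong (E := E) φ (-V) x = -nablaAlong φ V x := by
  ext v
  have h := nablaAlong_smul (f := fun _ ↦ (-1 : ℝ)) mdifferentiableAt_const hV v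
  rw [mvfderiv_const] at h
  rw [nablaAlong_congr (W := -V) (V := fun y ↦ (-1 : ℝ) • V y) (Eventually.of_forall fun y ↦ by
    rw [Pi.neg_apply, neg_one_smul]), h]
  simp

lemma nablaAlong_const_smul (c : ℝ) (hV : MDiffAlong E φ V x) :
    nablaAlong (E := E) φ (fun y ↦ c • V y) x = c • nablaAlong φ V x := by
  ext v
  rw [nablaAlong_smul (f := fun _ ↦ c) mdifferentiableAt_const hV v, mvfderiv_const]
  simp

lemma nablaAlong_sub (hV : SmoothAlong E φ V x) (hW : SmoothAlong E φ W x) :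
    nablaAlong (E := E) φ (V - W) x = nablaAlong φ V x - nablaAlong φ W x := by
  rw [nablaAlong_congr (W := V - W) (V := V + -W) (Eventually.of_forall fun y ↦ by
    rw [sub_eq_add_neg]), nablaAlong_add hV.mdiffAlong hW.neg.mdiffAlong,
    nablaAlong_neg hW.mdiffAlong, sub_eq_add_neg]

lemma leviCivita_metric_vec {X Y : Π p : N, TangentSpace 𝓘(ℝ, F) p} {p : N}
    (hX : MDiffAlong F (fun q : N ↦ q) X p) (hY : MDiffAlong F (fun q : N ↦ q) Y p)
    (u : TangentSpace 𝓘(ℝ, F) p) :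
    mvfderiv 𝓘(ℝ, F) (fun q ↦ inner ℝ (X q) (Y q)) p u =
      inner ℝ (leviCivita F N X p u) (Y p) + inner ℝ (X p) (leviCivita F N Y p u) := by
  have h := leviCivita_metric (mdiffAlong_extend u) hX hY
  rwa [FiberBundle.extend_apply_self] at h

/-- The induced connection is compatible with the metric. -/
lemma nablaAlong_metric (hφ : ContMDiff 𝓘(ℝ, E) 𝓘(ℝ, F) ∞ φ) (hV : SmoothAlong E φ V x)
    (hW : SmoothAlong E φ W x) (v : TangentSpace 𝓘(ℝ, E) x) :
    mvfderiv 𝓘(ℝ, E) (fun y ↦ inner ℝ (V y) (W y)) x v =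
      inner ℝ (nablaAlong φ V x v) (W x) + inner ℝ (V x) (nablaAlong φ W x v) := by
  have hφx : MDiffAt φ x := (hφ x).mdifferentiableAt (by simp)
  -- Both fields are reduced in turn, first `V` and then `W`, to restrictions of fields on `N`,
  -- where the chain rule and the metric property of `∇^N` apply.
  revert hW
  refine SmoothAlong.induction (P := fun V ↦ SmoothAlong E φ W x →
    mvfderiv 𝓘(ℝ, E) (fun y ↦ inner ℝ (V y) (W y)) x v =
      inner ℝ (nablaAlong φ V x v) (W x) + inner ℝ (V x) (nablaAlong φ W x v)) hφ ?_ ?_ ?_ ?_ hV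
  · intro V V' hV h ih hW
    rw [nablaAlong_congr h, h.self_of_nhds, ← ih hW, mvfderiv_congr]
    filter_upwards [h] with y hy
    rw [hy]
  · intro V V' hV hV' ih ih' hW
    simp only [Pi.add_apply, inner_add_left]
    rw [mvfderiv_fun_add (hV.inner_fun hW).mdifferentiableAt (hV'.inner_fun hW).mdifferentiableAt,
      nablaAlong_add hV.mdiffAlong hV'.mdiffAlong, _root_.add_apply, _root_.add_apply,
      ih hW, ih' hW, inner_add_left]
    ring
  · intro g V hg hV ih hW
    simp only [inner_smul_left, RCLike.conj_to_real]
    rw [mvfderiv_fun_mul hg.mdifferentiableAt (hV.inner_fun hW).mdifferentiableAt,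
      nablaAlong_smul hg.mdifferentiableAt hV.mdiffAlong, _root_.add_apply, _root_.smul_apply,
      _root_.smul_apply, ih hW, inner_add_left, inner_smul_left, inner_smul_left]
    simp only [RCLike.conj_to_real, smul_eq_mul]
    ring
  intro w hW
  have hw := (smoothAlong_extend (F := F) w).comp (E := E) hφ
  refine SmoothAlong.induction (P := fun W ↦
    mvfderiv 𝓘(ℝ, E) (fun y ↦ inner ℝ (extend F w (φ y)) (W y)) x v =
      inner ℝ (nablaAlong φ (fun y ↦ extend F w (φ y)) x v) (W x)
        + inner ℝ (extend F w (φ x)) (nablaAlong φ W x v)) hφ ?_ ?_ ?_ ?_ hW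
  · intro V V' hV h ih
    rw [nablaAlong_congr h, h.self_of_nhds, ← ih, mvfderiv_congr]
    filter_upwards [h] with y hy
    rw [hy]
  · intro V V' hV hV' ih ih'
    simp only [Pi.add_apply, inner_add_right]
    rw [mvfderiv_fun_add (hw.inner_fun hV).mdifferentiableAt (hw.inner_fun hV').mdifferentiableAt,
      nablaAlong_add hV.mdiffAlong hV'.mdiffAlong, _root_.add_apply, _root_.add_apply,
      ih, ih', inner_add_right]
    ring
  · intro g V hg hV ih
    simp only [inner_smul_right]
    rw [mvfderiv_fun_mul hg.mdifferentiableAt (hw.inner_fun hV).mdifferentiableAt,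
      nablaAlong_smul hg.mdifferentiableAt hV.mdiffAlong, _root_.add_apply, _root_.smul_apply,
      _root_.smul_apply, ih, inner_add_right, inner_smul_right, inner_smul_right]
    simp only [smul_eq_mul]
    ring
  · intro w'
    have h := mvfderiv_comp_map (φ := φ)
      ((mdiffAlong_extend w).inner_fun (mdiffAlong_extend w')) hφx v
    rw [leviCivita_metric_vec (mdiffAlong_extend w) (mdiffAlong_extend w')] at h
    rw [nablaAlong_comp (mdiffAlong_extend w) hφx, nablaAlong_comp (mdiffAlong_extend w') hφx]
    exact h

end MetricTorsion

/-! ### Torsion-freeness of the induced connection -/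

section Torsion

set_option linter.unusedSectionVars false

variable {E : Type*} [NormedAddCommGroup E] [NormedSpace ℝ E] [FiniteDimensional ℝ E]
  {M : Type*} [TopologicalSpace M] [ChartedSpace E M] [IsManifold 𝓘(ℝ, E) ∞ M]
  {F : Type*} [NormedAddCommGroup F] [NormedSpace ℝ F] [FiniteDimensional ℝ F]
  {N : Type*} [TopologicalSpace N] [ChartedSpace F N] [IsManifold 𝓘(ℝ, F) ∞ N]
  [RiemannianBundle (fun p : N ↦ TangentSpace 𝓘(ℝ, F) p)]
  [IsContMDiffRiemannianBundle 𝓘(ℝ, F) ∞ F (fun p : N ↦ TangentSpace 𝓘(ℝ, F) p)]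
  {φ : M → N} {V W : Π y : M, TangentSpace 𝓘(ℝ, F) (φ y)} {x : M}
  {X Y : Π y : M, TangentSpace 𝓘(ℝ, E) y}

lemma SmoothAlong.map_mfderiv (hφ : ContMDiff 𝓘(ℝ, E) 𝓘(ℝ, F) ∞ φ)
    (hX : SmoothAlong E (fun y : M ↦ y) X x) :
    SmoothAlong E φ (fun y ↦ mfderiv 𝓘(ℝ, E) 𝓘(ℝ, F) φ y (X y)) x :=
  eventually_contMDiffAt_mfderiv (Eventually.of_forall hφ) hX

lemma leviCivita_torsion_free {X Y : Π p : N, TangentSpace 𝓘(ℝ, F) p} {p : N}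
    (hX : MDiffAlong F (fun q : N ↦ q) X p) (hY : MDiffAlong F (fun q : N ↦ q) Y p) :
    VectorField.mlieBracket 𝓘(ℝ, F) X Y p =
      leviCivita F N Y p (X p) - leviCivita F N X p (Y p) := by
  have h := (CovariantDerivative.torsion_eq_zero_iff _).1 (leviCivita_torsion (E := F) (M := N))
    hX hY
  exact h.symm

/-- The Hessian `U(W g) - (∇_U W) g` of a function `g`, where `W` extends `w`. -/
def hessian (g : N → ℝ) {p : N} (u w : TangentSpace 𝓘(ℝ, F) p) : ℝ :=
  mvfderiv 𝓘(ℝ, F) (fun q ↦ mvfderiv 𝓘(ℝ, F) g q (extend F w q)) p u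
    - mvfderiv 𝓘(ℝ, F) g p (leviCivita F N (extend F w) p u)

lemma smoothFun_mvfderiv_extend {g : N → ℝ} {p : N} (hg : SmoothFun F g p)
    (w : TangentSpace 𝓘(ℝ, F) p) :
    SmoothFun F (fun q ↦ mvfderiv 𝓘(ℝ, F) g q (extend F w q)) p :=
  hg.derivative (smoothAlong_extend w)

lemma hessian_add {g : N → ℝ} {p : N} (hg : SmoothFun F g p) (u w w' : TangentSpace 𝓘(ℝ, F) p) :
    hessian g u (w + w') = hessian g u w + hessian g u w' := by
  unfold hessian
  rw [leviCivita_extend_add, mvfderiv_congr (g := fun q ↦ mvfderiv 𝓘(ℝ, F) g q (extend F w q)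
    + mvfderiv 𝓘(ℝ, F) g q (extend F w' q)),
    mvfderiv_fun_add (smoothFun_mvfderiv_extend hg w).mdifferentiableAt
      (smoothFun_mvfderiv_extend hg w').mdifferentiableAt, _root_.add_apply, _root_.add_apply,
      map_add]
  · ring
  · filter_upwards [extend_add w w'] with q hq
    rw [hq, Pi.add_apply, map_add]

lemma hessian_smul {g : N → ℝ} {p : N} (hg : SmoothFun F g p) (c : ℝ)
    (u w : TangentSpace 𝓘(ℝ, F) p) : hessian g u (c • w) = c * hessian g u w := by
  unfold hessian
  rw [leviCivita_extend_smul, mvfderiv_congr (g := fun q ↦ c * mvfderiv 𝓘(ℝ, F) g q (extend F w q)),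
    mvfderiv_fun_mul mdifferentiableAt_const
      (smoothFun_mvfderiv_extend hg w).mdifferentiableAt, mvfderiv_const]
  · simp
    ring
  · filter_upwards [extend_smul c w] with q hq
    rw [hq, map_smul, smul_eq_mul]

/-- The commutator of the derivations `U` and `W` is the bracket, which equals `∇_U W - ∇_W U` as
the torsion vanishes. -/
lemma hessian_symm {g : N → ℝ} {p : N} (hg : SmoothFun F g p)
    (u w : TangentSpace 𝓘(ℝ, F) p) : hessian g u w = hessian g w u := by
  have h1 := mvfderiv_mlieBracket (smoothAlong_extend u) (smoothAlong_extend w) hg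
  have h2 := leviCivita_torsion_free (mdiffAlong_extend u) (mdiffAlong_extend w)
  rw [h2, map_sub] at h1
  simp only [FiberBundle.extend_apply_self] at h1
  unfold hessian
  linarith

/-- The second derivative of a function along a vector field along `φ`. -/
lemma mvfderiv_along (hφ : ContMDiff 𝓘(ℝ, E) 𝓘(ℝ, F) ∞ φ) {g : N → ℝ}
    (hg : SmoothFun F g (φ x)) (hV : SmoothAlong E φ V x) (v : TangentSpace 𝓘(ℝ, E) x) :
    SmoothFun E (fun y ↦ mvfderiv 𝓘(ℝ, F) g (φ y) (V y)) x ∧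
    mvfderiv 𝓘(ℝ, E) (fun y ↦ mvfderiv 𝓘(ℝ, F) g (φ y) (V y)) x v =
      mvfderiv 𝓘(ℝ, F) g (φ x) (nablaAlong φ V x v)
      + hessian g (mfderiv 𝓘(ℝ, E) 𝓘(ℝ, F) φ x v) (V x) := by
  have hφx : MDiffAt φ x := (hφ x).mdifferentiableAt (by simp)
  refine SmoothAlong.induction (P := fun V ↦
    SmoothFun E (fun y ↦ mvfderiv 𝓘(ℝ, F) g (φ y) (V y)) x ∧
    mvfderiv 𝓘(ℝ, E) (fun y ↦ mvfderiv 𝓘(ℝ, F) g (φ y) (V y)) x v =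
      mvfderiv 𝓘(ℝ, F) g (φ x) (nablaAlong φ V x v)
      + hessian g (mfderiv 𝓘(ℝ, E) 𝓘(ℝ, F) φ x v) (V x)) hφ ?_ ?_ ?_ ?_ hV
  · intro V V' hV h ⟨ih1, ih2⟩
    have h' : (fun y ↦ mvfderiv 𝓘(ℝ, F) g (φ y) (V' y)) =ᶠ[𝓝 x]
        fun y ↦ mvfderiv 𝓘(ℝ, F) g (φ y) (V y) := by
      filter_upwards [h] with y hy
      rw [hy]
    exact ⟨ih1.congr h', by rw [mvfderiv_congr h', ih2, nablaAlong_congr h, h.self_of_nhds]⟩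
  · intro V V' hV hV' ⟨ih1, ih2⟩ ⟨ih1', ih2'⟩
    simp only [Pi.add_apply, map_add]
    refine ⟨ih1.add ih1', ?_⟩
    rw [mvfderiv_fun_add ih1.mdifferentiableAt ih1'.mdifferentiableAt,
      nablaAlong_add hV.mdiffAlong hV'.mdiffAlong, _root_.add_apply, _root_.add_apply, ih2, ih2',
      hessian_add hg, map_add]
    ring
  · intro f V hf hV ⟨ih1, ih2⟩
    simp only [map_smul, smul_eq_mul]
    refine ⟨hf.mul ih1, ?_⟩
    rw [mvfderiv_fun_mul hf.mdifferentiableAt ih1.mdifferentiableAt,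
      nablaAlong_smul hf.mdifferentiableAt hV.mdiffAlong, _root_.add_apply, _root_.smul_apply,
      _root_.smul_apply, ih2, hessian_smul hg, map_add, map_smul, map_smul]
    simp only [smul_eq_mul]
    ring
  · intro w
    refine ⟨(smoothFun_mvfderiv_extend hg w).comp hφ, ?_⟩
    have h := mvfderiv_comp_map (φ := φ) (smoothFun_mvfderiv_extend hg w).mdifferentiableAt hφx v
    rw [h, nablaAlong_comp (mdiffAlong_extend w) hφx]
    simp only [hessian, FiberBundle.extend_apply_self]
    ring

/-- The functions `ℓ ∘ chart`, with `ℓ` a linear form, separate tangent vectors, because the chart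
has invertible derivative. -/
lemma eq_of_mvfderiv_eq {p : N} {u v : TangentSpace 𝓘(ℝ, F) p}
    (h : ∀ g : N → ℝ, SmoothFun F g p → mvfderiv 𝓘(ℝ, F) g p u = mvfderiv 𝓘(ℝ, F) g p v) :
    u = v := by
  have hinj := (isInvertible_mfderiv_extChartAt (I := 𝓘(ℝ, F)) (mem_extChartAt_source p)).injective
  refine hinj ?_
  rw [← sub_eq_zero]
  refine SeparatingDual.eq_zero_of_forall_dual_eq_zero (R := ℝ) (V := F) fun ℓ ↦ ?_
  have hs : SmoothFun F (fun q ↦ ℓ (extChartAt 𝓘(ℝ, F) p q)) p := by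
    filter_upwards [chart_source_mem_nhds F p] with q hq
    exact ContMDiffAt.comp q ℓ.contMDiff.contMDiffAt (contMDiffAt_extChartAt' hq)
  have hc (u : TangentSpace 𝓘(ℝ, F) p) :
      mvfderiv 𝓘(ℝ, F) (fun q ↦ ℓ (extChartAt 𝓘(ℝ, F) p q)) p u =
        ℓ (mfderiv 𝓘(ℝ, F) 𝓘(ℝ, F) (extChartAt 𝓘(ℝ, F) p) p u) := by
    have h1 : MDiffAt (extChartAt 𝓘(ℝ, F) p) p := mdifferentiableAt_extChartAt (mem_chart_source F p)
    have := mvfderiv_comp_map (φ := extChartAt 𝓘(ℝ, F) p) (g := ℓ)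
      (ℓ.mdifferentiableAt) h1 u
    rw [this]
    simp [mvfderiv]
    rfl
  have := h _ hs
  rw [hc, hc] at this
  exact (map_sub ℓ _ _).trans (sub_eq_zero.2 this)

/-- The induced connection is torsion free. -/
lemma nablaAlong_torsion_free (hφ : ContMDiff 𝓘(ℝ, E) 𝓘(ℝ, F) ∞ φ)
    (hX : SmoothAlong E (fun y : M ↦ y) X x) (hY : SmoothAlong E (fun y : M ↦ y) Y x) :
    nablaAlong φ (fun y ↦ mfderiv 𝓘(ℝ, E) 𝓘(ℝ, F) φ y (Y y)) x (X x)
      - nablaAlong φ (fun y ↦ mfderiv 𝓘(ℝ, E) 𝓘(ℝ, F) φ y (X y)) x (Y x) =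
    mfderiv 𝓘(ℝ, E) 𝓘(ℝ, F) φ x (VectorField.mlieBracket 𝓘(ℝ, E) X Y x) := by
  -- Tested on a function `g`: the commutator formula for `g ∘ φ` contains two Hessian terms of `g`,
  -- which cancel by symmetry, and what remains is the derivative of `g` along the asserted
  -- identity.
  refine eq_of_mvfderiv_eq fun g hg ↦ ?_
  have hφx (y : M) : MDiffAt φ y := (hφ y).mdifferentiableAt (by simp)
  have hc : ∀ᶠ y in 𝓝 x, ∀ v : TangentSpace 𝓘(ℝ, E) y,
      mvfderiv 𝓘(ℝ, E) (fun y ↦ g (φ y)) y v =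
        mvfderiv 𝓘(ℝ, F) g (φ y) (mfderiv 𝓘(ℝ, E) 𝓘(ℝ, F) φ y v) := by
    filter_upwards [hφ.continuous.continuousAt.eventually hg] with y hy v
    exact mvfderiv_comp_map (hy.mdifferentiableAt (by simp)) (hφx y) v
  have hb := mvfderiv_mlieBracket hX hY (hg.comp (E := E) hφ)
  rw [hc.self_of_nhds, mvfderiv_congr (hc.mono fun y hy ↦ hy (Y y)),
    mvfderiv_congr (hc.mono fun y hy ↦ hy (X y)), (mvfderiv_along hφ hg (hY.map_mfderiv hφ) _).2,
    (mvfderiv_along hφ hg (hX.map_mfderiv hφ) _).2, hessian_symm hg] at hb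
  rw [hb, map_sub]
  ring

end Torsion

/-! ### Smooth orthonormal frames and independence of the trace from the basis -/

section OrthonormalFrame

set_option linter.unusedSectionVars false

variable {E : Type*} [NormedAddCommGroup E] [NormedSpace ℝ E]
  {M : Type*} [TopologicalSpace M] [ChartedSpace E M] {f : M → ℝ} {x : M}

lemma SmoothFun.inv (hf : SmoothFun E f x) (h : f x ≠ 0) : SmoothFun E (fun y ↦ (f y)⁻¹) x := by
  filter_upwards [hf, hf.self_of_nhds.continuousAt.eventually_ne h] with z hz hz'
  exact hz.inv₀ hz'

lemma SmoothFun.sqrt (hf : SmoothFun E f x) (h : f x ≠ 0) :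
    SmoothFun E (fun y ↦ √(f y)) x := by
  filter_upwards [hf, hf.self_of_nhds.continuousAt.eventually_ne h] with z hz hz'
  exact (Real.contDiffAt_sqrt hz').contMDiffAt.comp z hz

variable {F : Type*} [NormedAddCommGroup F] [NormedSpace ℝ F] [FiniteDimensional ℝ F]
  {N : Type*} [TopologicalSpace N] [ChartedSpace F N] [IsManifold 𝓘(ℝ, F) ∞ N]
  [RiemannianBundle (fun p : N ↦ TangentSpace 𝓘(ℝ, F) p)]
  [IsContMDiffRiemannianBundle 𝓘(ℝ, F) ∞ F (fun p : N ↦ TangentSpace 𝓘(ℝ, F) p)]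

/-- Gram-Schmidt orthogonalization preserves smoothness. -/
lemma SmoothAlong.gramSchmidt {n : ℕ} {p : N} {s : Fin n → Π q : N, TangentSpace 𝓘(ℝ, F) q}
    (hs : ∀ i, SmoothAlong F (fun q : N ↦ q) (s i) p)
    (hli : LinearIndependent ℝ fun i ↦ s i p) (i : Fin n) :
    SmoothAlong F (fun q : N ↦ q)
      (fun q ↦ InnerProductSpace.gramSchmidt ℝ (fun j ↦ s j q) i) p := by
  induction i using WellFoundedLT.induction with
  | _ i ih =>
    -- The projection coefficients are written with the inverse of `⟨g_j, g_j⟩`, which is nonzero at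
    -- `p`, so that their smoothness can be read off.
    refine ((hs i).sub (SmoothAlong.sum (Finset.Iio i) (U := fun j q ↦
      (inner ℝ (InnerProductSpace.gramSchmidt ℝ (fun j ↦ s j q) j) (s i q) *
        (inner ℝ (InnerProductSpace.gramSchmidt ℝ (fun j ↦ s j q) j)
          (InnerProductSpace.gramSchmidt ℝ (fun j ↦ s j q) j))⁻¹) •
        InnerProductSpace.gramSchmidt ℝ (fun j ↦ s j q) j) contMDiff_id fun j hj ↦ ?_)).congr
      (Eventually.of_forall fun q ↦ ?_)
    · have hj := ih j (Finset.mem_Iio.1 hj)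
      have h0 := InnerProductSpace.gramSchmidt_ne_zero j hli
      exact hj.smul ((hj.inner_fun (hs i)).mul ((hj.inner_fun hj).inv (by simpa using h0)))
    · rw [InnerProductSpace.gramSchmidt_def]
      simp [Submodule.starProjection_singleton, div_eq_mul_inv]

/-- There is a smooth orthonormal frame near every point. -/
lemma exists_orthonormal_frame (p : N) :
    ∃ e : Fin (finrank ℝ F) → Π q : N, TangentSpace 𝓘(ℝ, F) q,
      (∀ i, SmoothAlong F (fun q : N ↦ q) (e i) p) ∧
      ∀ᶠ q in 𝓝 p, Orthonormal ℝ fun i ↦ e i q := by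
  let t := trivializationAt F (fun q : N ↦ TangentSpace 𝓘(ℝ, F) q) p
  have hp : p ∈ t.baseSet := FiberBundle.mem_baseSet_trivializationAt F _ p
  let b := Module.finBasis ℝ F
  let s (i) : Π q : N, TangentSpace 𝓘(ℝ, F) q := extend F (t.symmₗ ℝ p (b i))
  have hs (i) : SmoothAlong F (fun q : N ↦ q) (s i) p := smoothAlong_extend _
  have hli : ∀ᶠ q in 𝓝 p, LinearIndependent ℝ fun i ↦ s i q := by
    filter_upwards [eventually_extend_eq (F := F) (p := p),
      eventually_mem_baseSet (F := F) (φ := fun q : N ↦ q) (x := p) continuousAt_id] with q hq hqt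
    have h1 (i) : s i q = t.symmₗ ℝ q (b i) := by
      simp only [s]
      rw [hq]
      exact congrArg _ (t.linearMapAt_symmₗ hp (b i))
    simp only [h1]
    refine b.linearIndependent.map' (t.symmₗ ℝ q) (LinearMap.ker_eq_bot.2 ?_)
    exact (Function.LeftInverse.injective (g := t.linearMapAt ℝ q) fun v ↦ t.linearMapAt_symmₗ hqt v)
  refine ⟨fun i q ↦ InnerProductSpace.gramSchmidtNormed ℝ (fun j ↦ s j q) i, fun i ↦ ?_, ?_⟩
  · have hg := SmoothAlong.gramSchmidt hs hli.self_of_nhds i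
    have h0 := InnerProductSpace.gramSchmidt_ne_zero i hli.self_of_nhds
    have h1 := (hg.inner_fun hg).sqrt (by simpa using h0)
    refine (hg.smul (h1.inv (by simpa [Real.sqrt_eq_zero'] using h0))).congr
      (Eventually.of_forall fun q ↦ ?_)
    simp [InnerProductSpace.gramSchmidtNormed]
  · filter_upwards [hli] with q hq
    exact InnerProductSpace.gramSchmidtNormed_orthonormal hq

/-- Formulated for orthonormal families over any index type of the right cardinality, so that it
serves both for local frames and for the frame `e_i, J e_i` indexed by a sum type. -/
lemma sum_inner_smul_of_orthonormal {p : N} {ι : Type*} [Fintype ι]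
    (hι : Fintype.card ι = finrank ℝ F) {e : ι → TangentSpace 𝓘(ℝ, F) p}
    (he : Orthonormal ℝ e) (v : TangentSpace 𝓘(ℝ, F) p) : ∑ i, inner ℝ (e i) v • e i = v := by
  have hcard : Fintype.card ι = finrank ℝ (TangentSpace 𝓘(ℝ, F) p) := hι
  let b : OrthonormalBasis ι ℝ (TangentSpace 𝓘(ℝ, F) p) :=
    OrthonormalBasis.mk he (by
      rw [he.linearIndependent.span_eq_top_of_card_eq_finrank' hcard])
  have := b.sum_repr' v
  simpa [b] using this

/-- The metric trace of a bilinear map may be computed in any orthonormal basis. -/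
lemma trace_eq_sum {W : Type*} [AddCommGroup W] [Module ℝ W] {p : N}
    {b : TangentSpace 𝓘(ℝ, F) p → TangentSpace 𝓘(ℝ, F) p → W}
    (hb : IsBilinearMap ℝ b) {ι : Type*} [Fintype ι] [DecidableEq ι]
    {e : ι → TangentSpace 𝓘(ℝ, F) p}
    (he : Orthonormal ℝ e) (hsum : ∀ v, ∑ i, inner ℝ (e i) v • e i = v) :
    trace b = ∑ i, b (e i) (e i) := by
  let B := hb.toLinearMap
  change ∑ k, B _ _ = ∑ i, B (e i) (e i)
  have h (k) := hsum (stdOrthonormalBasis ℝ (TangentSpace 𝓘(ℝ, F) p) k)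
  -- The change of basis matrix is orthogonal (Parseval in the standard basis).
  have h1 (i j) : ∑ k, inner ℝ (e i) (stdOrthonormalBasis ℝ (TangentSpace 𝓘(ℝ, F) p) k)
      * inner ℝ (e j) (stdOrthonormalBasis ℝ (TangentSpace 𝓘(ℝ, F) p) k) =
        if i = j then (1 : ℝ) else 0 := by
    rw [← orthonormal_iff_ite.1 he i j,
      ← (stdOrthonormalBasis ℝ (TangentSpace 𝓘(ℝ, F) p)).sum_inner_mul_inner (e i) (e j)]
    exact Finset.sum_congr rfl fun k _ ↦ by rw [real_inner_comm (e j)]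
  calc ∑ k, B (stdOrthonormalBasis ℝ (TangentSpace 𝓘(ℝ, F) p) k)
        (stdOrthonormalBasis ℝ (TangentSpace 𝓘(ℝ, F) p) k)
      = ∑ k, ∑ i, ∑ j, (inner ℝ (e i) (stdOrthonormalBasis ℝ (TangentSpace 𝓘(ℝ, F) p) k)
        * inner ℝ (e j) (stdOrthonormalBasis ℝ (TangentSpace 𝓘(ℝ, F) p) k)) •
          B (e i) (e j) := by
        refine Finset.sum_congr rfl fun k _ ↦ ?_
        conv_lhs => rw [← h k]
        simp only [map_sum, map_smul, LinearMap.sum_apply, LinearMap.smul_apply, Finset.smul_sum,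
          smul_smul]
        rw [Finset.sum_comm]
        refine Finset.sum_congr rfl fun i _ ↦ Finset.sum_congr rfl fun j _ ↦ ?_
        rw [mul_comm]
    _ = ∑ i, ∑ j, (if i = j then (1 : ℝ) else 0) • B (e i) (e j) := by
        rw [Finset.sum_comm]
        refine Finset.sum_congr rfl fun i _ ↦ ?_
        rw [Finset.sum_comm]
        refine Finset.sum_congr rfl fun j _ ↦ ?_
        rw [← Finset.sum_smul, h1]
    _ = ∑ i, B (e i) (e i) := by simp

end OrthonormalFrame

/-! ### Smoothness of covariant derivatives -/

section Smoothness

set_option linter.unusedSectionVars false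

variable {F : Type*} [NormedAddCommGroup F] [NormedSpace ℝ F] [FiniteDimensional ℝ F]
  {N : Type*} [TopologicalSpace N] [ChartedSpace F N] [IsManifold 𝓘(ℝ, F) ∞ N]
  [RiemannianBundle (fun p : N ↦ TangentSpace 𝓘(ℝ, F) p)]
  [IsContMDiffRiemannianBundle 𝓘(ℝ, F) ∞ F (fun p : N ↦ TangentSpace 𝓘(ℝ, F) p)]
  {p : N} {X Y Z : Π q : N, TangentSpace 𝓘(ℝ, F) q}

lemma smoothFun_koszul (hX : SmoothAlong F (fun q : N ↦ q) X p)
    (hY : SmoothAlong F (fun q : N ↦ q) Y p) (hZ : SmoothAlong F (fun q : N ↦ q) Z p) :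
    SmoothFun F (koszul X Y Z) p :=
  (SmoothFun.const _).mul (((((((hY.inner_fun hZ).derivative hX).add ((hX.inner_fun hZ).derivative hY)).sub
    ((hX.inner_fun hY).derivative hZ)).add ((hX.mlieBracket hY).inner_fun hZ)).sub
    ((hX.mlieBracket hZ).inner_fun hY)).sub ((hY.mlieBracket hZ).inner_fun hX))

/-- A vector field with smooth inner products with smooth fields is smooth. -/
lemma SmoothAlong.of_inner (h : ∀ Z : Π q : N, TangentSpace 𝓘(ℝ, F) q,
    SmoothAlong F (fun q : N ↦ q) Z p → SmoothFun F (fun q ↦ inner ℝ (X q) (Z q)) p) :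
    SmoothAlong F (fun q : N ↦ q) X p := by
  obtain ⟨e, he, ho⟩ := exists_orthonormal_frame (F := F) p
  refine (SmoothAlong.sum (φ := fun q : N ↦ q) Finset.univ contMDiff_id
    fun i _ ↦ (he i).smul (h _ (he i))).congr ?_
  filter_upwards [ho] with q hq
  rw [← sum_inner_smul_of_orthonormal (Fintype.card_fin _) hq (X q)]
  exact Finset.sum_congr rfl fun i _ ↦ by
    rw [sum_inner_smul_of_orthonormal (Fintype.card_fin _) hq (X q), real_inner_comm]

/-- The connection is defined pointwise through bases chosen without regard to smoothness, so
smoothness is drawn from the inner products, which Koszul's formula supplies. -/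
lemma SmoothAlong.leviCivita_apply (hX : SmoothAlong F (fun q : N ↦ q) X p)
    (hY : SmoothAlong F (fun q : N ↦ q) Y p) :
    SmoothAlong F (fun q : N ↦ q) (fun q ↦ leviCivita F N Y q (X q)) p := by
  refine .of_inner fun Z hZ ↦ (smoothFun_koszul hX hY hZ).congr ?_
  filter_upwards [hX.eventually, hY.eventually, hZ.eventually] with q hXq hYq hZq
  exact inner_leviCivitaFun hXq.mdiffAlong hYq.mdiffAlong hZq.mdiffAlong

variable {E : Type*} [NormedAddCommGroup E] [NormedSpace ℝ E] [FiniteDimensional ℝ E]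
  {M : Type*} [TopologicalSpace M] [ChartedSpace E M] [IsManifold 𝓘(ℝ, E) ∞ M]
  {φ : M → N} {V : Π y : M, TangentSpace 𝓘(ℝ, F) (φ y)} {x : M}
  {T : Π y : M, TangentSpace 𝓘(ℝ, E) y}

/-- `∇_V X` is smooth if `V` is a smooth field along `φ` and `X` a smooth field on `N`. -/
lemma SmoothAlong.leviCivita_along (hφ : ContMDiff 𝓘(ℝ, E) 𝓘(ℝ, F) ∞ φ)
    (hX : SmoothAlong F (fun q : N ↦ q) X (φ x)) (hV : SmoothAlong E φ V x) :
    SmoothAlong E φ (fun y ↦ leviCivita F N X (φ y) (V y)) x := by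
  refine SmoothAlong.induction (P := fun V ↦
    SmoothAlong E φ (fun y ↦ leviCivita F N X (φ y) (V y)) x)
    hφ ?_ ?_ ?_ ?_ hV
  · intro V W _ h ih
    refine ih.congr ?_
    filter_upwards [h] with y hy
    rw [hy]
  · intro V W _ _ ih ih'
    exact (ih.add ih').congr (Eventually.of_forall fun y ↦ by simp only [Pi.add_apply, map_add])
  · intro f V hf _ ih
    exact (ih.smul hf).congr (Eventually.of_forall fun y ↦ by simp only [map_smul])
  · intro w
    exact ((smoothAlong_extend w).leviCivita_apply hX).comp hφ

/-- The definition at `y` uses the trivialization centred at `φ y`, which varies with `y`, so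
smoothness is not visible from it. The induction reduces to restricted fields, where
`nablaAlong_comp` removes the trivialization. -/
lemma SmoothAlong.nablaAlong_apply (hφ : ContMDiff 𝓘(ℝ, E) 𝓘(ℝ, F) ∞ φ)
    (hT : SmoothAlong E (fun y : M ↦ y) T x) (hV : SmoothAlong E φ V x) :
    SmoothAlong E φ (fun y ↦ nablaAlong φ V y (T y)) x := by
  refine SmoothAlong.induction (P := fun V ↦
    SmoothAlong E φ (fun y ↦ nablaAlong φ V y (T y)) x) hφ ?_ ?_ ?_ ?_ hV
  · intro V W _ h ih
    refine ih.congr ?_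
    filter_upwards [h.eventually_nhds] with y hy
    rw [nablaAlong_congr hy]
  · intro V W hV hW ih ih'
    refine (ih.add ih').congr ?_
    filter_upwards [hV.eventually, hW.eventually] with y hy hy'
    rw [nablaAlong_add hy.mdiffAlong hy'.mdiffAlong, _root_.add_apply, Pi.add_apply]
  · intro f V hf hV ih
    refine ((hV.smul (hf.derivative hT)).add (ih.smul hf)).congr ?_
    filter_upwards [hV.eventually, hf.eventually] with y hy hy'
    rw [nablaAlong_smul hy'.mdifferentiableAt hy.mdiffAlong, Pi.add_apply]
  · intro w
    have hw := smoothAlong_extend (F := F) w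
    refine (SmoothAlong.leviCivita_along hφ hw (hT.map_mfderiv hφ)).congr ?_
    filter_upwards [hφ.continuous.continuousAt.eventually hw.eventually] with y hy
    exact nablaAlong_comp hy.mdiffAlong ((hφ y).mdifferentiableAt (by simp)) _

end Smoothness

/-! ### The curvature tensor: linearity, pullback and symmetries -/

section Curvature

set_option linter.unusedSectionVars false

variable {F : Type*} [NormedAddCommGroup F] [NormedSpace ℝ F] [FiniteDimensional ℝ F]
  {N : Type*} [TopologicalSpace N] [ChartedSpace F N] [IsManifold 𝓘(ℝ, F) ∞ N]
  [RiemannianBundle (fun p : N ↦ TangentSpace 𝓘(ℝ, F) p)]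
  [IsContMDiffRiemannianBundle 𝓘(ℝ, F) ∞ F (fun p : N ↦ TangentSpace 𝓘(ℝ, F) p)]
  {p : N} {X Y Z : Π q : N, TangentSpace 𝓘(ℝ, F) q}

/-- The second covariant derivative `∇_U ∇_V X - ∇_{∇_U V} X`, where `V` extends `v`. -/
def secondCov (X : Π q : N, TangentSpace 𝓘(ℝ, F) q) {p : N} (u v : TangentSpace 𝓘(ℝ, F) p) :
    TangentSpace 𝓘(ℝ, F) p :=
  leviCivita F N (fun q ↦ leviCivita F N X q (extend F v q)) p u
    - leviCivita F N X p (leviCivita F N (extend F v) p u)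

lemma secondCov_add_right (hX : SmoothAlong F (fun q : N ↦ q) X p)
    (u v w : TangentSpace 𝓘(ℝ, F) p) :
    secondCov X u (v + w) = secondCov X u v + secondCov X u w := by
  have hv := (smoothAlong_extend (F := F) v).leviCivita_apply hX
  have hw := (smoothAlong_extend (F := F) w).leviCivita_apply hX
  have h : leviCivita F N (fun q ↦ leviCivita F N X q (extend F (v + w) q)) p =
      leviCivita F N (fun q ↦ leviCivita F N X q (extend F v q)) p
      + leviCivita F N (fun q ↦ leviCivita F N X q (extend F w q)) p := by
    rw [← leviCivita_add hv.mdiffAlong hw.mdiffAlong]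
    refine leviCivita_congr (hv.add hw).mdiffAlong ?_
    filter_upwards [extend_add v w] with q hq
    rw [hq, Pi.add_apply, map_add, Pi.add_apply]
  unfold secondCov
  rw [h, leviCivita_extend_add, _root_.add_apply, _root_.add_apply, map_add]
  abel

lemma secondCov_smul_right (hX : SmoothAlong F (fun q : N ↦ q) X p) (c : ℝ)
    (u v : TangentSpace 𝓘(ℝ, F) p) :
    secondCov X u (c • v) = c • secondCov X u v := by
  have hv := (smoothAlong_extend (F := F) v).leviCivita_apply hX
  have h : leviCivita F N (fun q ↦ leviCivita F N X q (extend F (c • v) q)) p u =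
      c • leviCivita F N (fun q ↦ leviCivita F N X q (extend F v q)) p u := by
    have h1 := leviCivita_smul (g := fun _ ↦ c) mdifferentiableAt_const hv.mdiffAlong u
    rw [mvfderiv_const, _root_.zero_apply, zero_smul, zero_add] at h1
    rw [← h1, leviCivita_congr (hv.const_smul c).mdiffAlong]
    filter_upwards [extend_smul c v] with q hq
    rw [hq, map_smul]
  unfold secondCov
  rw [h, leviCivita_extend_smul, _root_.smul_apply, map_smul, smul_sub]

lemma secondCov_add_left (u u' v : TangentSpace 𝓘(ℝ, F) p) :
    secondCov X (u + u') v = secondCov X u v + secondCov X u' v := by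
  unfold secondCov
  rw [map_add, map_add, map_add]
  abel

lemma secondCov_smul_left (c : ℝ) (u v : TangentSpace 𝓘(ℝ, F) p) :
    secondCov X (c • u) v = c • secondCov X u v := by
  unfold secondCov
  rw [map_smul, map_smul, map_smul, smul_sub]

lemma secondCov_congr (hX : SmoothAlong F (fun q : N ↦ q) X p)
    (h : ∀ᶠ q in 𝓝 p, Y q = X q) (u v : TangentSpace 𝓘(ℝ, F) p) :
    secondCov Y u v = secondCov X u v := by
  have hv := (smoothAlong_extend (F := F) v).leviCivita_apply hX
  unfold secondCov
  rw [leviCivita_congr hX.mdiffAlong h, leviCivita_congr hv.mdiffAlong]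
  filter_upwards [h.eventually_nhds, hX.eventually] with q hq hXq
  rw [leviCivita_congr hXq.mdiffAlong hq]

lemma secondCov_add (hX : SmoothAlong F (fun q : N ↦ q) X p)
    (hY : SmoothAlong F (fun q : N ↦ q) Y p) (u v : TangentSpace 𝓘(ℝ, F) p) :
    secondCov (X + Y) u v = secondCov X u v + secondCov Y u v := by
  have hv := (smoothAlong_extend (F := F) v).leviCivita_apply hX
  have hw := (smoothAlong_extend (F := F) v).leviCivita_apply hY
  have h : leviCivita F N (fun q ↦ leviCivita F N (X + Y) q (extend F v q)) p =
      leviCivita F N (fun q ↦ leviCivita F N X q (extend F v q)) p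
      + leviCivita F N (fun q ↦ leviCivita F N Y q (extend F v q)) p := by
    rw [← leviCivita_add hv.mdiffAlong hw.mdiffAlong]
    refine leviCivita_congr (hv.add hw).mdiffAlong ?_
    filter_upwards [hX.eventually, hY.eventually] with q hXq hYq
    rw [leviCivita_add hXq.mdiffAlong hYq.mdiffAlong, Pi.add_apply, _root_.add_apply]
  unfold secondCov
  rw [h, leviCivita_add hX.mdiffAlong hY.mdiffAlong, _root_.add_apply, _root_.add_apply]
  abel

lemma leviCivita_const_smul (c : ℝ) (hX : MDiffAlong F (fun q : N ↦ q) X p) :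
    leviCivita F N (fun q ↦ c • X q) p = c • leviCivita F N X p := by
  ext u
  rw [leviCivita_smul (g := fun _ ↦ c) mdifferentiableAt_const hX u, mvfderiv_const]
  simp

lemma secondCov_const_smul (hX : SmoothAlong F (fun q : N ↦ q) X p) (c : ℝ)
    (u v : TangentSpace 𝓘(ℝ, F) p) :
    secondCov (fun q ↦ c • X q) u v = c • secondCov X u v := by
  have hv := (smoothAlong_extend (F := F) v).leviCivita_apply hX
  have h : leviCivita F N (fun q ↦ leviCivita F N (fun q ↦ c • X q) q (extend F v q)) p =
      c • leviCivita F N (fun q ↦ leviCivita F N X q (extend F v q)) p := by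
    rw [← leviCivita_const_smul c hv.mdiffAlong]
    refine leviCivita_congr (hv.const_smul c).mdiffAlong ?_
    filter_upwards [hX.eventually] with q hXq
    rw [leviCivita_const_smul c hXq.mdiffAlong, _root_.smul_apply]
  unfold secondCov
  rw [h, leviCivita_const_smul c hX.mdiffAlong, _root_.smul_apply, _root_.smul_apply, smul_sub]

/-- Torsion-freeness absorbs the bracket term. Linearity in each slot and antisymmetry are then
inherited from the second covariant derivative. -/
lemma curvature_eq_secondCov (u v w : TangentSpace 𝓘(ℝ, F) p) :
    curvature u v w = secondCov (extend F w) u v - secondCov (extend F w) v u := by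
  unfold curvature secondCov
  rw [leviCivita_torsion_free (mdiffAlong_extend u) (mdiffAlong_extend v), map_sub,
    FiberBundle.extend_apply_self, FiberBundle.extend_apply_self]
  abel

lemma curvature_antisymm (u v w : TangentSpace 𝓘(ℝ, F) p) :
    curvature u v w = -curvature v u w := by
  rw [curvature_eq_secondCov, curvature_eq_secondCov, neg_sub]

lemma curvature_smul_left (c : ℝ) (u v w : TangentSpace 𝓘(ℝ, F) p) :
    curvature (c • u) v w = c • curvature u v w := by
  simp only [curvature_eq_secondCov, secondCov_smul_left,
    secondCov_smul_right (smoothAlong_extend w), smul_sub]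

lemma curvature_add_mid (u v v' w : TangentSpace 𝓘(ℝ, F) p) :
    curvature u (v + v') w = curvature u v w + curvature u v' w := by
  simp only [curvature_eq_secondCov, secondCov_add_left,
    secondCov_add_right (smoothAlong_extend w)]
  abel

lemma curvature_smul_mid (c : ℝ) (u v w : TangentSpace 𝓘(ℝ, F) p) :
    curvature u (c • v) w = c • curvature u v w := by
  simp only [curvature_eq_secondCov, secondCov_smul_left,
    secondCov_smul_right (smoothAlong_extend w), smul_sub]

lemma curvature_add_right (u v w w' : TangentSpace 𝓘(ℝ, F) p) :
    curvature u v (w + w') = curvature u v w + curvature u v w' := by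
  have h (u v) := (secondCov_congr ((smoothAlong_extend (F := F) w).add (smoothAlong_extend w'))
    (extend_add w w') u v).trans (secondCov_add (smoothAlong_extend w) (smoothAlong_extend w') u v)
  simp only [curvature_eq_secondCov, h]
  abel

lemma curvature_smul_right (c : ℝ) (u v w : TangentSpace 𝓘(ℝ, F) p) :
    curvature u v (c • w) = c • curvature u v w := by
  have h (u v) := (secondCov_congr ((smoothAlong_extend (F := F) w).const_smul c)
    (extend_smul c w) u v).trans (secondCov_const_smul (smoothAlong_extend w) c u v)
  simp only [curvature_eq_secondCov, h, smul_sub]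

variable {E : Type*} [NormedAddCommGroup E] [NormedSpace ℝ E] [FiniteDimensional ℝ E]
  {M : Type*} [TopologicalSpace M] [ChartedSpace E M] [IsManifold 𝓘(ℝ, E) ∞ M]
  {φ : M → N} {V : Π y : M, TangentSpace 𝓘(ℝ, F) (φ y)} {x : M}
  {S T : Π y : M, TangentSpace 𝓘(ℝ, E) y}

/-- The product rule for the endomorphism field `∇X` applied to `V`: `secondCov X` is the covariant
derivative of `∇X`. -/
lemma nablaAlong_leviCivita_apply (hφ : ContMDiff 𝓘(ℝ, E) 𝓘(ℝ, F) ∞ φ)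
    (hX : SmoothAlong F (fun q : N ↦ q) X (φ x)) (hV : SmoothAlong E φ V x)
    (v : TangentSpace 𝓘(ℝ, E) x) :
    nablaAlong φ (fun y ↦ leviCivita F N X (φ y) (V y)) x v =
      leviCivita F N X (φ x) (nablaAlong φ V x v)
        + secondCov X (mfderiv 𝓘(ℝ, E) 𝓘(ℝ, F) φ x v) (V x) := by
  have hφx : MDiffAt φ x := (hφ x).mdifferentiableAt (by simp)
  have hs {V : Π y : M, TangentSpace 𝓘(ℝ, F) (φ y)} (hV : SmoothAlong E φ V x) :=
    (SmoothAlong.leviCivita_along hφ hX hV).mdiffAlong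
  refine SmoothAlong.induction (P := fun V ↦
    nablaAlong φ (fun y ↦ leviCivita F N X (φ y) (V y)) x v =
      leviCivita F N X (φ x) (nablaAlong φ V x v)
        + secondCov X (mfderiv 𝓘(ℝ, E) 𝓘(ℝ, F) φ x v) (V x)) hφ ?_ ?_ ?_ ?_ hV
  · intro V W _ h ih
    rw [nablaAlong_congr h, h.self_of_nhds, ← ih]
    rw [nablaAlong_congr]
    filter_upwards [h] with y hy
    rw [hy]
  · intro V W hV hW ih ih'
    rw [nablaAlong_congr (V := (fun y ↦ leviCivita F N X (φ y) (V y)) +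
      fun y ↦ leviCivita F N X (φ y) (W y)), nablaAlong_add (hs hV) (hs hW),
      nablaAlong_add hV.mdiffAlong hW.mdiffAlong, _root_.add_apply, _root_.add_apply, ih, ih',
      Pi.add_apply, secondCov_add_right hX, map_add]
    · abel
    · exact Eventually.of_forall fun y ↦ by simp only [Pi.add_apply, map_add]
  · intro f V hf hV ih
    rw [nablaAlong_congr (V := fun y ↦ f y • leviCivita F N X (φ y) (V y)),
      nablaAlong_smul hf.mdifferentiableAt (hs hV),
      nablaAlong_smul hf.mdifferentiableAt hV.mdiffAlong, ih, secondCov_smul_right hX, map_add,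
      map_smul, map_smul, smul_add]
    · abel
    · exact Eventually.of_forall fun y ↦ by simp only [map_smul]
  · intro w
    rw [nablaAlong_comp ((smoothAlong_extend w).leviCivita_apply hX).mdiffAlong hφx,
      nablaAlong_comp (mdiffAlong_extend w) hφx]
    simp only [secondCov, FiberBundle.extend_apply_self]
    abel

/-- The curvature of the induced connection is the pullback of the curvature of `N`. -/
lemma nablaAlong_curvature (hφ : ContMDiff 𝓘(ℝ, E) 𝓘(ℝ, F) ∞ φ)
    (hS : SmoothAlong E (fun y : M ↦ y) S x) (hT : SmoothAlong E (fun y : M ↦ y) T x)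
    (hV : SmoothAlong E φ V x) :
    nablaAlong φ (fun y ↦ nablaAlong φ V y (T y)) x (S x)
      - nablaAlong φ (fun y ↦ nablaAlong φ V y (S y)) x (T x)
      - nablaAlong φ V x (VectorField.mlieBracket 𝓘(ℝ, E) S T x) =
    curvature (mfderiv 𝓘(ℝ, E) 𝓘(ℝ, F) φ x (S x)) (mfderiv 𝓘(ℝ, E) 𝓘(ℝ, F) φ x (T x)) (V x) := by
  have hφx (y : M) : MDiffAt φ y := (hφ y).mdifferentiableAt (by simp)
  refine SmoothAlong.induction (P := fun V ↦
    nablaAlong φ (fun y ↦ nablaAlong φ V y (T y)) x (S x)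
      - nablaAlong φ (fun y ↦ nablaAlong φ V y (S y)) x (T x)
      - nablaAlong φ V x (VectorField.mlieBracket 𝓘(ℝ, E) S T x) =
    curvature (mfderiv 𝓘(ℝ, E) 𝓘(ℝ, F) φ x (S x)) (mfderiv 𝓘(ℝ, E) 𝓘(ℝ, F) φ x (T x)) (V x))
    hφ ?_ ?_ ?_ ?_ hV
  · intro V W _ h ih
    have h2 (T : Π y : M, TangentSpace 𝓘(ℝ, E) y) :
        nablaAlong (E := E) φ (fun y ↦ nablaAlong φ W y (T y)) x =
        nablaAlong φ (fun y ↦ nablaAlong φ V y (T y)) x := by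
      refine nablaAlong_congr ?_
      filter_upwards [h.eventually_nhds] with y hy
      rw [nablaAlong_congr hy]
    rw [h2, h2, nablaAlong_congr h, h.self_of_nhds, ih]
  · intro V W hV hW ih ih'
    have h2 {T : Π y : M, TangentSpace 𝓘(ℝ, E) y} (hT : SmoothAlong E (fun y : M ↦ y) T x) :
        nablaAlong (E := E) φ (fun y ↦ nablaAlong φ (V + W) y (T y)) x =
        nablaAlong φ (fun y ↦ nablaAlong φ V y (T y)) x
          + nablaAlong φ (fun y ↦ nablaAlong φ W y (T y)) x := by
      rw [← nablaAlong_add (SmoothAlong.nablaAlong_apply hφ hT hV).mdiffAlong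
        (SmoothAlong.nablaAlong_apply hφ hT hW).mdiffAlong]
      refine nablaAlong_congr ?_
      filter_upwards [hV.eventually, hW.eventually] with y hy hy'
      rw [nablaAlong_add hy.mdiffAlong hy'.mdiffAlong, Pi.add_apply, _root_.add_apply]
    rw [h2 hS, h2 hT, nablaAlong_add hV.mdiffAlong hW.mdiffAlong, Pi.add_apply,
      curvature_add_right, ← ih, ← ih']
    simp only [_root_.add_apply]
    abel
  · intro f V hf hV ih
    -- Of the four terms of the product rule, the two with one derivative on `f` and one on `V` are
    -- together symmetric in `S` and `T`; the second derivatives of `f` cancel against the bracket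
    -- term.
    have h2 {S T : Π y : M, TangentSpace 𝓘(ℝ, E) y} (hT : SmoothAlong E (fun y : M ↦ y) T x) :
        nablaAlong (E := E) φ (fun y ↦ nablaAlong φ (fun y ↦ f y • V y) y (T y)) x (S x) =
        mvfderiv 𝓘(ℝ, E) (fun y ↦ mvfderiv 𝓘(ℝ, E) f y (T y)) x (S x) • V x
          + mvfderiv 𝓘(ℝ, E) f x (T x) • nablaAlong φ V x (S x)
          + (mvfderiv 𝓘(ℝ, E) f x (S x) • nablaAlong φ V x (T x)
          + f x • nablaAlong φ (fun y ↦ nablaAlong φ V y (T y)) x (S x)) := by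
      have hs := SmoothAlong.nablaAlong_apply hφ hT hV
      have hd := hf.derivative hT
      rw [← nablaAlong_smul hf.mdifferentiableAt hs.mdiffAlong,
        ← nablaAlong_smul hd.mdifferentiableAt hV.mdiffAlong, ← _root_.add_apply,
        ← nablaAlong_add (hV.smul hd).mdiffAlong (hs.smul hf).mdiffAlong]
      congr 1
      refine nablaAlong_congr ?_
      filter_upwards [hV.eventually, hf.eventually] with y hy hy'
      rw [nablaAlong_smul hy'.mdifferentiableAt hy.mdiffAlong, Pi.add_apply]
    rw [h2 hS, h2 hT, nablaAlong_smul hf.mdifferentiableAt hV.mdiffAlong,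
      mvfderiv_mlieBracket hS hT hf, curvature_smul_right, ← ih]
    module
  · intro w
    have hw := smoothAlong_extend (F := F) w
    -- On a restricted field the first-order terms cancel against the bracket, by torsion-freeness;
    -- the antisymmetrized `secondCov` is the curvature.
    have h2 {S T : Π y : M, TangentSpace 𝓘(ℝ, E) y} (hT : SmoothAlong E (fun y : M ↦ y) T x) :
        nablaAlong (E := E) φ (fun y ↦ nablaAlong φ (fun y ↦ extend F w (φ y)) y (T y)) x (S x) =
        leviCivita F N (extend F w) (φ x)
          (nablaAlong φ (fun y ↦ mfderiv 𝓘(ℝ, E) 𝓘(ℝ, F) φ y (T y)) x (S x))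
        + secondCov (extend F w) (mfderiv 𝓘(ℝ, E) 𝓘(ℝ, F) φ x (S x))
          (mfderiv 𝓘(ℝ, E) 𝓘(ℝ, F) φ x (T x)) := by
      rw [← nablaAlong_leviCivita_apply hφ hw (hT.map_mfderiv hφ)]
      congr 1
      refine nablaAlong_congr ?_
      filter_upwards [hφ.continuous.continuousAt.eventually hw.eventually] with y hy
      exact nablaAlong_comp hy.mdiffAlong (hφx y) _
    rw [h2 hS, h2 hT, nablaAlong_comp hw.mdiffAlong (hφx x),
      ← nablaAlong_torsion_free hφ hS hT, map_sub]
    beta_reduce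
    rw [FiberBundle.extend_apply_self, curvature_eq_secondCov]
    abel

/-- The curvature tensor evaluated on smooth vector fields. -/
lemma leviCivita_curvature (hX : SmoothAlong F (fun q : N ↦ q) X p)
    (hY : SmoothAlong F (fun q : N ↦ q) Y p) (hZ : SmoothAlong F (fun q : N ↦ q) Z p) :
    leviCivita F N (fun q ↦ leviCivita F N Z q (Y q)) p (X p)
      - leviCivita F N (fun q ↦ leviCivita F N Z q (X q)) p (Y p)
      - leviCivita F N Z p (VectorField.mlieBracket 𝓘(ℝ, F) X Y p) =
    curvature (X p) (Y p) (Z p) := by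
  have h := nablaAlong_curvature (φ := fun q : N ↦ q) contMDiff_id hX hY hZ
  have hid : mfderiv 𝓘(ℝ, F) 𝓘(ℝ, F) (fun q : N ↦ q) p = ContinuousLinearMap.id ℝ _ :=
    mfderiv_id
  have h2 {Y : Π q : N, TangentSpace 𝓘(ℝ, F) q} (hY : SmoothAlong F (fun q : N ↦ q) Y p) :
      nablaAlong (E := F) (fun q : N ↦ q) (fun q ↦ nablaAlong (fun q : N ↦ q) Z q (Y q)) p =
      leviCivita F N (fun q ↦ leviCivita F N Z q (Y q)) p := by
    rw [← nablaAlong_id (hY.leviCivita_apply hZ).mdiffAlong]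
    refine nablaAlong_congr (φ := fun q : N ↦ q) ?_
    filter_upwards [hZ.eventually] with q hq
    rw [nablaAlong_id hq.mdiffAlong]
  rw [h2 hX, h2 hY, nablaAlong_id hZ.mdiffAlong, hid] at h
  exact h

/-- Apply the commutator formula to the function `⟨W, Z⟩` and expand by metric compatibility; the
mixed products `⟨∇W, ∇Z⟩` are symmetric in the two directions and drop out. -/
lemma inner_curvature_skew (u v w z : TangentSpace 𝓘(ℝ, F) p) :
    inner ℝ (curvature u v w) z = -inner ℝ w (curvature u v z) := by
  have hu := smoothAlong_extend (F := F) u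
  have hv := smoothAlong_extend (F := F) v
  have hw := smoothAlong_extend (F := F) w
  have hz := smoothAlong_extend (F := F) z
  have h2 {U V : Π q : N, TangentSpace 𝓘(ℝ, F) q} (hV : SmoothAlong F (fun q : N ↦ q) V p) :
      mvfderiv 𝓘(ℝ, F) (fun q ↦ mvfderiv 𝓘(ℝ, F)
        (fun q ↦ inner ℝ (extend F w q) (extend F z q)) q (V q)) p (U p) =
      inner ℝ (leviCivita F N (fun q ↦ leviCivita F N (extend F w) q (V q)) p (U p)) z
      + inner ℝ (leviCivita F N (extend F w) p (V p)) (leviCivita F N (extend F z) p (U p))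
      + (inner ℝ (leviCivita F N (extend F w) p (U p)) (leviCivita F N (extend F z) p (V p))
      + inner ℝ w (leviCivita F N (fun q ↦ leviCivita F N (extend F z) q (V q)) p (U p))) := by
    have h3 := hV.leviCivita_apply hw
    have h4 := hV.leviCivita_apply hz
    have h5 := leviCivita_metric_vec h3.mdiffAlong hz.mdiffAlong (U p)
    have h6 := leviCivita_metric_vec hw.mdiffAlong h4.mdiffAlong (U p)
    rw [FiberBundle.extend_apply_self] at h5 h6
    rw [← h5, ← h6, ← _root_.add_apply, ← mvfderiv_fun_add (h3.inner_fun hz).mdifferentiableAt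
      (hw.inner_fun h4).mdifferentiableAt]
    congr 1
    refine mvfderiv_congr ?_
    filter_upwards [hw.eventually, hz.eventually] with q hwq hzq
    exact leviCivita_metric_vec hwq.mdiffAlong hzq.mdiffAlong _
  have hb := mvfderiv_mlieBracket hu hv (hw.inner_fun hz)
  rw [h2 hu, h2 hv, leviCivita_metric_vec hw.mdiffAlong hz.mdiffAlong] at hb
  simp only [FiberBundle.extend_apply_self] at hb
  simp only [curvature, inner_sub_left, inner_sub_right]
  linarith

/-- By torsion-freeness the terms of the cyclic sum regroup into the three double brackets of the
Jacobi identity. -/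
lemma curvature_bianchi (u v w : TangentSpace 𝓘(ℝ, F) p) :
    curvature u v w + curvature v w u + curvature w u v = 0 := by
  have h2 (u v w : TangentSpace 𝓘(ℝ, F) p) :
      leviCivita F N (fun q ↦ leviCivita F N (extend F w) q (extend F v q)) p u
      - leviCivita F N (fun q ↦ leviCivita F N (extend F v) q (extend F w q)) p u
      - leviCivita F N (extend F u) p
        (VectorField.mlieBracket 𝓘(ℝ, F) (extend F v) (extend F w) p) =
      VectorField.mlieBracket 𝓘(ℝ, F) (extend F u)
        (VectorField.mlieBracket 𝓘(ℝ, F) (extend F v) (extend F w)) p := by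
    have hu := smoothAlong_extend (F := F) u
    have hv := smoothAlong_extend (F := F) v
    have hw := smoothAlong_extend (F := F) w
    rw [leviCivita_torsion_free hu.mdiffAlong (hv.mlieBracket hw).mdiffAlong,
      FiberBundle.extend_apply_self]
    congr 1
    rw [sub_eq_iff_eq_add, ← _root_.add_apply, ← leviCivita_add (hv.mlieBracket hw).mdiffAlong
      (hw.leviCivita_apply hv).mdiffAlong]
    congr 1
    refine leviCivita_congr ((hv.mlieBracket hw).add (hw.leviCivita_apply hv)).mdiffAlong ?_
    filter_upwards [hv.eventually, hw.eventually] with q hvq hwq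
    rw [Pi.add_apply, leviCivita_torsion_free hvq.mdiffAlong hwq.mdiffAlong, sub_add_cancel]
  have jac := mlieBracket_jacobi (smoothAlong_extend (F := F) u) (smoothAlong_extend (F := F) v)
    (smoothAlong_extend (F := F) w)
  rw [← h2, ← h2, ← h2] at jac
  unfold curvature
  rw [← jac]
  abel

/-- Linear algebra: four instances of the Bianchi identity combined with the skew symmetry in each
pair of slots. -/
lemma inner_curvature_pair (u v w z : TangentSpace 𝓘(ℝ, F) p) :
    inner ℝ (curvature u v w) z = inner ℝ (curvature w z u) v := by
  have b (u v w z : TangentSpace 𝓘(ℝ, F) p) : inner ℝ (curvature u v w) z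
      + inner ℝ (curvature v w u) z + inner ℝ (curvature w u v) z = 0 := by
    rw [← inner_add_left, ← inner_add_left, curvature_bianchi, inner_zero_left]
  have a (u v w z : TangentSpace 𝓘(ℝ, F) p) :
      inner ℝ (curvature u v w) z = -inner ℝ (curvature v u w) z := by
    rw [curvature_antisymm, inner_neg_left]
  have s (u v w z : TangentSpace 𝓘(ℝ, F) p) :
      inner ℝ (curvature u v w) z = -inner ℝ (curvature u v z) w := by
    rw [inner_curvature_skew, real_inner_comm]
  linarith [b u v w z, b v w z u, b w z u v, b z u v w, a u v w z, a w z u v, a v w u z,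
    s v w u z, a w u v z, s w u v z, s u v w z, s w z u v, a v w z u, s w z v u, a z v w u,
    s z v w u, a z u w v, s z u w v, a u w z v, s u w z v, a z u v w, s z u v w, a v z u w,
    s v z u w, s u v z w, a u v z w, a w z v u, a u z v w, s u z v w, a u z w v]

end Curvature

/-! ### Parallelism of the complex structure and its effect on curvature -/

section Kahler

set_option linter.unusedSectionVars false

variable {F : Type*} [NormedAddCommGroup F] [NormedSpace ℝ F] [FiniteDimensional ℝ F]
  {N : Type*} [TopologicalSpace N] [ChartedSpace F N] [IsManifold 𝓘(ℝ, F) ∞ N]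
  [RiemannianBundle (fun p : N ↦ TangentSpace 𝓘(ℝ, F) p)]
  [IsContMDiffRiemannianBundle 𝓘(ℝ, F) ∞ F (fun p : N ↦ TangentSpace 𝓘(ℝ, F) p)]
  {p : N} {X Y Z : Π q : N, TangentSpace 𝓘(ℝ, F) q}
  {J : Π p : N, TangentSpace 𝓘(ℝ, F) p →L[ℝ] TangentSpace 𝓘(ℝ, F) p}

lemma IsKahler.inner_left (hJ : IsKahler J) (u v : TangentSpace 𝓘(ℝ, F) p) :
    inner ℝ (J p u) v = -inner ℝ u (J p v) := by
  rw [← hJ.hermitian p u (J p v), hJ.sq, inner_neg_right, neg_neg]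

lemma IsKahler.smoothAlong (hJ : IsKahler J) (hX : SmoothAlong F (fun q : N ↦ q) X p) :
    SmoothAlong F (fun q : N ↦ q) (fun q ↦ J q (X q)) p := by
  filter_upwards [hX] with q hq
  exact ContMDiffAt.clm_bundle_apply (F₁ := F) (F₂ := F)
    (E₁ := fun p : N ↦ TangentSpace 𝓘(ℝ, F) p) (E₂ := fun p : N ↦ TangentSpace 𝓘(ℝ, F) p)
    (b := fun q ↦ q) (hJ.smooth q) hq

/-- The complex structure of a Kähler manifold is parallel. -/
lemma IsKahler.leviCivita_map (hJ : IsKahler J) (hY : SmoothAlong F (fun q : N ↦ q) Y p)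
    (u : TangentSpace 𝓘(ℝ, F) p) :
    leviCivita F N (fun q ↦ J q (Y q)) p u = J p (leviCivita F N Y p u) := by
  -- `S X Y Z` is `⟨(∇_X J)Y, Z⟩`. Skewness of `J` makes it skew in `Y, Z`; closedness of the
  -- fundamental form and vanishing of the Nijenhuis tensor give two further linear relations, and
  -- the three together force `S = 0`.
  let S (X Y Z : Π q : N, TangentSpace 𝓘(ℝ, F) q) : ℝ :=
    inner ℝ (leviCivita F N (fun q ↦ J q (Y q)) p (X p)) (Z p)
      - inner ℝ (J p (leviCivita F N Y p (X p))) (Z p)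
  have skew {X Y Z : Π q : N, TangentSpace 𝓘(ℝ, F) q} (hY : SmoothAlong F (fun q : N ↦ q) Y p)
      (hZ : SmoothAlong F (fun q : N ↦ q) Z p) : S X Y Z = -S X Z Y := by
    have h1 := leviCivita_metric_vec (hJ.smoothAlong hY).mdiffAlong hZ.mdiffAlong (X p)
    have h2 := leviCivita_metric_vec (hJ.smoothAlong hZ).mdiffAlong hY.mdiffAlong (X p)
    have h3 : (fun q ↦ inner ℝ (J q (Y q)) (Z q)) = fun q ↦ (-1 : ℝ) * inner ℝ (J q (Z q)) (Y q) := by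
      ext q
      rw [hJ.inner_left, real_inner_comm]
      ring
    rw [h3, mvfderiv_fun_mul mdifferentiableAt_const
      ((hJ.smoothAlong hZ).inner_fun hY).mdifferentiableAt, mvfderiv_const] at h1
    simp only [smul_zero, add_zero, _root_.smul_apply, h2, smul_eq_mul] at h1
    simp only [S, hJ.inner_left, real_inner_comm] at h1 ⊢
    simp at h1
    linarith
  have closed {X Y Z : Π q : N, TangentSpace 𝓘(ℝ, F) q} (hX : SmoothAlong F (fun q : N ↦ q) X p)
      (hY : SmoothAlong F (fun q : N ↦ q) Y p) (hZ : SmoothAlong F (fun q : N ↦ q) Z p) :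
      S X Z Y + S Y X Z + S Z Y X = 0 := by
    have h := hJ.closed p X Y Z hX.self_of_nhds hY.self_of_nhds hZ.self_of_nhds
    rw [leviCivita_metric_vec hY.mdiffAlong (hJ.smoothAlong hZ).mdiffAlong,
      leviCivita_metric_vec hZ.mdiffAlong (hJ.smoothAlong hX).mdiffAlong,
      leviCivita_metric_vec hX.mdiffAlong (hJ.smoothAlong hY).mdiffAlong,
      leviCivita_torsion_free hX.mdiffAlong hY.mdiffAlong,
      leviCivita_torsion_free hY.mdiffAlong hZ.mdiffAlong,
      leviCivita_torsion_free hZ.mdiffAlong hX.mdiffAlong] at h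
    simp only [inner_sub_left] at h
    simp only [S, hJ.inner_left]
    rw [real_inner_comm (leviCivita F N (fun q ↦ J q (Z q)) p (X p)),
      real_inner_comm (leviCivita F N (fun q ↦ J q (X q)) p (Y p)),
      real_inner_comm (leviCivita F N (fun q ↦ J q (Y q)) p (Z p))] at h
    linarith
  have integ {X Y Z : Π q : N, TangentSpace 𝓘(ℝ, F) q} (hX : SmoothAlong F (fun q : N ↦ q) X p)
      (hY : SmoothAlong F (fun q : N ↦ q) Y p) :
      S (fun q ↦ J q (X q)) Y Z - S (fun q ↦ J q (Y q)) X Z - S Y X (fun q ↦ J q (Z q))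
        + S X Y (fun q ↦ J q (Z q)) = 0 := by
    have h := congrArg (fun v ↦ inner ℝ v (Z p))
      (hJ.integrable p X Y hX.self_of_nhds hY.self_of_nhds)
    rw [leviCivita_torsion_free hX.mdiffAlong hY.mdiffAlong,
      leviCivita_torsion_free hX.mdiffAlong (hJ.smoothAlong hY).mdiffAlong,
      leviCivita_torsion_free (hJ.smoothAlong hX).mdiffAlong hY.mdiffAlong,
      leviCivita_torsion_free (hJ.smoothAlong hX).mdiffAlong (hJ.smoothAlong hY).mdiffAlong] at h
    simp only [inner_sub_left, map_sub, inner_zero_left, hJ.inner_left] at h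
    simp only [S, hJ.hermitian]
    simp only [hJ.inner_left]
    linarith
  have zero {X Y Z : Π q : N, TangentSpace 𝓘(ℝ, F) q} (hX : SmoothAlong F (fun q : N ↦ q) X p)
      (hY : SmoothAlong F (fun q : N ↦ q) Y p) (hZ : SmoothAlong F (fun q : N ↦ q) Z p) :
      S (fun q ↦ J q (X q)) Y Z = 0 := by
    -- With `a, b, c` the cyclic permutations of `S (JX) Y Z`, the relation reads `a + b - c = 0`.
    -- Its three rotations give `a = b = c = 0`.
    have cyc {X Y Z : Π q : N, TangentSpace 𝓘(ℝ, F) q} (hX : SmoothAlong F (fun q : N ↦ q) X p)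
        (hY : SmoothAlong F (fun q : N ↦ q) Y p) (hZ : SmoothAlong F (fun q : N ↦ q) Z p) :
        S (fun q ↦ J q (X q)) Y Z + S (fun q ↦ J q (Y q)) Z X - S (fun q ↦ J q (Z q)) X Y = 0 := by
      have h1 := integ (Z := Z) hX hY
      have h2 := closed hX hY (hJ.smoothAlong hZ)
      have h3 := skew (X := X) hY (hJ.smoothAlong hZ)
      have h4 := skew (X := fun q ↦ J q (Z q)) hX hY
      have h5 := skew (X := fun q ↦ J q (Y q)) hX hZ
      linarith
    linarith [cyc hX hY hZ, cyc hY hZ hX, cyc hZ hX hY]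
  refine ext_inner_right ℝ fun w ↦ ?_
  -- Every `u` is `J(-Ju)`, so the restriction to first arguments of the form `JX` is harmless.
  have h := zero (smoothAlong_extend (F := F) (-(J p u))) hY (smoothAlong_extend (F := F) w)
  simp only [S, FiberBundle.extend_apply_self, map_neg, hJ.sq, neg_neg] at h
  linarith

/-- `J` commutes with `∇`, hence with all three terms of the curvature. The field `J W` need not be
the chosen extension of `J w`, hence the appeal to `leviCivita_curvature`. -/
lemma IsKahler.curvature_map (hJ : IsKahler J) (u v w : TangentSpace 𝓘(ℝ, F) p) :
    curvature u v (J p w) = J p (curvature u v w) := by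
  have hu := smoothAlong_extend (F := F) u
  have hv := smoothAlong_extend (F := F) v
  have hw := smoothAlong_extend (F := F) w
  have h := leviCivita_curvature hu hv (hJ.smoothAlong hw)
  have h2 {U V : Π q : N, TangentSpace 𝓘(ℝ, F) q} (hV : SmoothAlong F (fun q : N ↦ q) V p) :
      leviCivita F N (fun q ↦ leviCivita F N (fun q ↦ J q (extend F w q)) q (V q)) p (U p) =
      J p (leviCivita F N (fun q ↦ leviCivita F N (extend F w) q (V q)) p (U p)) := by
    rw [← hJ.leviCivita_map (hV.leviCivita_apply hw)]
    congr 1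
    refine leviCivita_congr (hJ.smoothAlong (hV.leviCivita_apply hw)).mdiffAlong ?_
    filter_upwards [hw.eventually] with q hq
    exact hJ.leviCivita_map hq _
  rw [h2 hu, h2 hv, hJ.leviCivita_map hw] at h
  simp only [FiberBundle.extend_apply_self] at h
  rw [← h, curvature, map_sub, map_sub]

lemma IsKahler.inner_curvature (hJ : IsKahler J) (u v w z : TangentSpace 𝓘(ℝ, F) p) :
    inner ℝ (curvature (J p u) (J p v) w) z = inner ℝ (curvature u v w) z := by
  rw [inner_curvature_pair, hJ.curvature_map, hJ.hermitian, ← inner_curvature_pair]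

end Kahler

/-! ### Second fundamental form; formulas of Gauss, Weingarten and Codazzi -/

section Submanifold

set_option linter.unusedSectionVars false

variable {E : Type*} [NormedAddCommGroup E] [NormedSpace ℝ E] [FiniteDimensional ℝ E]
  {M : Type*} [TopologicalSpace M] [ChartedSpace E M] [IsManifold 𝓘(ℝ, E) ∞ M]
  [RiemannianBundle (fun x : M ↦ TangentSpace 𝓘(ℝ, E) x)]
  [IsContMDiffRiemannianBundle 𝓘(ℝ, E) ∞ E (fun x : M ↦ TangentSpace 𝓘(ℝ, E) x)]
  {F : Type*} [NormedAddCommGroup F] [NormedSpace ℝ F] [FiniteDimensional ℝ F]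
  {N : Type*} [TopologicalSpace N] [ChartedSpace F N] [IsManifold 𝓘(ℝ, F) ∞ N]
  [RiemannianBundle (fun p : N ↦ TangentSpace 𝓘(ℝ, F) p)]
  [IsContMDiffRiemannianBundle 𝓘(ℝ, F) ∞ F (fun p : N ↦ TangentSpace 𝓘(ℝ, F) p)]
  {φ : M → N} {x : M} {ξ : Π y : M, TangentSpace 𝓘(ℝ, F) (φ y)}
  {U V W : Π y : M, TangentSpace 𝓘(ℝ, E) y}

/-- The trace is the Riesz representative of `ℓ`. `tangentPart` and `shapeOperator` are both defined
in this form. -/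
lemma inner_trace_smul {ℓ : TangentSpace 𝓘(ℝ, E) x → ℝ} (hℓ : IsLinearMap ℝ ℓ)
    (z : TangentSpace 𝓘(ℝ, E) x) :
    inner ℝ (trace fun v w : TangentSpace 𝓘(ℝ, E) x ↦ ℓ v • w) z = ℓ z := by
  conv_rhs => rw [← (stdOrthonormalBasis ℝ (TangentSpace 𝓘(ℝ, E) x)).sum_repr' z]
  have h : ∀ v, ℓ v = hℓ.mk' ℓ v := fun _ ↦ rfl
  simp only [h, trace, sum_inner, inner_smul_left, map_sum, map_smul, smul_eq_mul]
  exact Finset.sum_congr rfl fun i _ ↦ mul_comm _ _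

lemma secondFundamentalForm_symm_aux (hφ : ContMDiff 𝓘(ℝ, E) 𝓘(ℝ, F) ∞ φ)
    (hV : SmoothAlong E (fun y : M ↦ y) V x) (hW : SmoothAlong E (fun y : M ↦ y) W x) :
    nablaAlong φ (fun y ↦ mfderiv 𝓘(ℝ, E) 𝓘(ℝ, F) φ y (W y)) x (V x)
        - mfderiv 𝓘(ℝ, E) 𝓘(ℝ, F) φ x (leviCivita E M W x (V x)) =
      nablaAlong φ (fun y ↦ mfderiv 𝓘(ℝ, E) 𝓘(ℝ, F) φ y (V y)) x (W x)
        - mfderiv 𝓘(ℝ, E) 𝓘(ℝ, F) φ x (leviCivita E M V x (W x)) := by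
  have h := nablaAlong_torsion_free hφ hV hW
  rw [leviCivita_torsion_free hV.mdiffAlong hW.mdiffAlong, map_sub] at h
  rw [sub_eq_sub_iff_sub_eq_sub, h]

/-- The Gauss formula. `B` was defined with the particular extension of `W x`; after exchanging the
arguments by symmetry, `W` enters through `W x` alone, so any extension gives the same value. -/
lemma nablaAlong_mfderiv (hφ : ContMDiff 𝓘(ℝ, E) 𝓘(ℝ, F) ∞ φ)
    (hW : SmoothAlong E (fun y : M ↦ y) W x) (v : TangentSpace 𝓘(ℝ, E) x) :
    nablaAlong φ (fun y ↦ mfderiv 𝓘(ℝ, E) 𝓘(ℝ, F) φ y (W y)) x v =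
      mfderiv 𝓘(ℝ, E) 𝓘(ℝ, F) φ x (leviCivita E M W x v)
        + secondFundamentalForm F φ x v (W x) := by
  have h1 := secondFundamentalForm_symm_aux hφ (smoothAlong_extend (F := E) v) hW
  have h2 := secondFundamentalForm_symm_aux hφ (smoothAlong_extend (F := E) v)
    (smoothAlong_extend (F := E) (W x))
  simp only [FiberBundle.extend_apply_self] at h1 h2
  rw [secondFundamentalForm, h2, ← h1]
  abel

lemma secondFundamentalForm_symm (hφ : ContMDiff 𝓘(ℝ, E) 𝓘(ℝ, F) ∞ φ)
    (v w : TangentSpace 𝓘(ℝ, E) x) :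
    secondFundamentalForm F φ x v w = secondFundamentalForm F φ x w v := by
  have h := secondFundamentalForm_symm_aux hφ (smoothAlong_extend (F := E) v)
    (smoothAlong_extend (F := E) w)
  simp only [FiberBundle.extend_apply_self] at h
  exact h

lemma isBilinearMap_secondFundamentalForm (hφ : ContMDiff 𝓘(ℝ, E) 𝓘(ℝ, F) ∞ φ) :
    IsBilinearMap ℝ (fun v w : TangentSpace 𝓘(ℝ, E) x ↦ secondFundamentalForm F φ x v w) := by
  have add (u v w : TangentSpace 𝓘(ℝ, E) x) : secondFundamentalForm F φ x (u + v) w =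
      secondFundamentalForm F φ x u w + secondFundamentalForm F φ x v w := by
    simp only [secondFundamentalForm, map_add]
    abel
  have smul (c : ℝ) (v w : TangentSpace 𝓘(ℝ, E) x) : secondFundamentalForm F φ x (c • v) w =
      c • secondFundamentalForm F φ x v w := by
    simp only [secondFundamentalForm, map_smul, smul_sub]
  refine ⟨add, smul, fun u v w ↦ ?_, fun c v w ↦ ?_⟩
  · simp only [secondFundamentalForm_symm hφ u, add]
  · simp only [secondFundamentalForm_symm hφ v, smul]

/-- Both connections are metric and `φ` is isometric, so `⟨B(u, v), dφ w⟩` is skew in `v, w`. It is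
also symmetric in `u, v`, and a trilinear form with both symmetries vanishes. -/
lemma IsIsometricImmersion.inner_secondFundamentalForm (hφ : IsIsometricImmersion E F φ)
    (u v w : TangentSpace 𝓘(ℝ, E) x) :
    inner ℝ (secondFundamentalForm F φ x u v) (mfderiv 𝓘(ℝ, E) 𝓘(ℝ, F) φ x w) = 0 := by
  have skew (u v w : TangentSpace 𝓘(ℝ, E) x) :
      inner ℝ (secondFundamentalForm F φ x u v) (mfderiv 𝓘(ℝ, E) 𝓘(ℝ, F) φ x w) =
      -inner ℝ (secondFundamentalForm F φ x u w) (mfderiv 𝓘(ℝ, E) 𝓘(ℝ, F) φ x v) := by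
    have hv := smoothAlong_extend (F := E) v
    have hw := smoothAlong_extend (F := E) w
    have h := nablaAlong_metric hφ.smooth (hv.map_mfderiv hφ.smooth) (hw.map_mfderiv hφ.smooth) u
    simp only [hφ.isometric] at h
    rw [leviCivita_metric_vec hv.mdiffAlong hw.mdiffAlong, nablaAlong_mfderiv hφ.smooth hv,
      nablaAlong_mfderiv hφ.smooth hw] at h
    simp only [inner_add_left, inner_add_right, hφ.isometric, FiberBundle.extend_apply_self] at h
    rw [real_inner_comm (secondFundamentalForm F φ x u w)] at h
    linarith
  have h1 := skew u v w
  have h2 := skew w u v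
  have h3 := skew v w u
  rw [secondFundamentalForm_symm hφ.smooth] at h2 h3
  have h4 := secondFundamentalForm_symm hφ.smooth w v
  have h5 := secondFundamentalForm_symm hφ.smooth v u
  simp only [h4, h5] at h1 h2 h3
  linarith

lemma IsIsometricImmersion.inner_tangentPart (u : TangentSpace 𝓘(ℝ, F) (φ x))
    (w : TangentSpace 𝓘(ℝ, E) x) :
    inner ℝ (tangentPart E φ x u) w = inner ℝ u (mfderiv 𝓘(ℝ, E) 𝓘(ℝ, F) φ x w) :=
  inner_trace_smul ⟨fun a b ↦ by rw [map_add, inner_add_right],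
    fun c a ↦ by rw [map_smul, inner_smul_right, smul_eq_mul]⟩ w

lemma inner_shapeOperator (hφ : ContMDiff 𝓘(ℝ, E) 𝓘(ℝ, F) ∞ φ) (η : TangentSpace 𝓘(ℝ, F) (φ x))
    (v w : TangentSpace 𝓘(ℝ, E) x) :
    inner ℝ (shapeOperator φ x η v) w = inner ℝ (secondFundamentalForm F φ x v w) η :=
  inner_trace_smul ⟨fun a b ↦ by
      rw [(isBilinearMap_secondFundamentalForm hφ).add_right, inner_add_left],
    fun c a ↦ by
      rw [(isBilinearMap_secondFundamentalForm hφ).smul_right, inner_smul_left, smul_eq_mul]; rfl⟩ w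

lemma IsIsometricImmersion.inner_normalPart (hφ : IsIsometricImmersion E F φ)
    (u : TangentSpace 𝓘(ℝ, F) (φ x)) (w : TangentSpace 𝓘(ℝ, E) x) :
    inner ℝ (normalPart E φ x u) (mfderiv 𝓘(ℝ, E) 𝓘(ℝ, F) φ x w) = 0 := by
  rw [normalPart, inner_sub_left, hφ.isometric, IsIsometricImmersion.inner_tangentPart, sub_self]

/-- The Weingarten formula. -/
lemma IsIsometricImmersion.nablaAlong_normal (hφ : IsIsometricImmersion E F φ)
    (hξ : SmoothAlong E φ ξ x)
    (hn : ∀ (y : M) (w : TangentSpace 𝓘(ℝ, E) y),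
      inner ℝ (ξ y) (mfderiv 𝓘(ℝ, E) 𝓘(ℝ, F) φ y w) = 0)
    (v : TangentSpace 𝓘(ℝ, E) x) :
    nablaAlong φ ξ x v = normalNabla φ ξ x v
      - mfderiv 𝓘(ℝ, E) 𝓘(ℝ, F) φ x (shapeOperator φ x (ξ x) v) := by
  have h : tangentPart E φ x (nablaAlong φ ξ x v) = -shapeOperator φ x (ξ x) v := by
    refine ext_inner_right ℝ fun w ↦ ?_
    have hw := smoothAlong_extend (F := E) w
    have h := nablaAlong_metric hφ.smooth hξ (hw.map_mfderiv hφ.smooth) v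
    simp only [hn] at h
    rw [mvfderiv_const, nablaAlong_mfderiv hφ.smooth hw, inner_add_right, hn,
      FiberBundle.extend_apply_self, _root_.zero_apply] at h
    rw [IsIsometricImmersion.inner_tangentPart, inner_neg_left, inner_shapeOperator hφ.smooth,
      real_inner_comm (ξ x)]
    linarith
  rw [normalNabla, normalPart, h, map_neg]
  abel

lemma SmoothAlong.secondFundamentalForm_apply (hφ : ContMDiff 𝓘(ℝ, E) 𝓘(ℝ, F) ∞ φ)
    (hV : SmoothAlong E (fun y : M ↦ y) V x) (hW : SmoothAlong E (fun y : M ↦ y) W x) :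
    SmoothAlong E φ (fun y ↦ secondFundamentalForm F φ y (V y) (W y)) x := by
  refine ((SmoothAlong.nablaAlong_apply hφ hV (hW.map_mfderiv hφ)).sub
    ((hV.leviCivita_apply hW).map_mfderiv hφ)).congr ?_
  filter_upwards [hW.eventually] with y hy
  rw [Pi.sub_apply, nablaAlong_mfderiv hφ hy, add_sub_cancel_left]

/-- The bases in the definition need not vary smoothly; independence of the trace from the basis
allows a smooth local frame instead. -/
lemma smoothAlong_tension (hφ : ContMDiff 𝓘(ℝ, E) 𝓘(ℝ, F) ∞ φ) :
    SmoothAlong E φ (tension E F φ) x := by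
  obtain ⟨e, he, ho⟩ := exists_orthonormal_frame (F := E) x
  refine (SmoothAlong.sum (φ := φ) Finset.univ hφ
    fun i _ ↦ SmoothAlong.secondFundamentalForm_apply hφ (he i) (he i)).congr ?_
  filter_upwards [ho] with y hy
  exact trace_eq_sum (isBilinearMap_secondFundamentalForm hφ) hy
    (sum_inner_smul_of_orthonormal (Fintype.card_fin _) hy)

lemma SmoothAlong.shapeOperator_apply (hφ : ContMDiff 𝓘(ℝ, E) 𝓘(ℝ, F) ∞ φ)
    (hξ : SmoothAlong E φ ξ x) (hV : SmoothAlong E (fun y : M ↦ y) V x) :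
    SmoothAlong E (fun y : M ↦ y) (fun y ↦ shapeOperator φ y (ξ y) (V y)) x := by
  refine .of_inner fun Z hZ ↦ ?_
  simp only [inner_shapeOperator hφ]
  exact (SmoothAlong.secondFundamentalForm_apply hφ hV hZ).inner_fun hξ

lemma SmoothAlong.normalNabla_apply (hφ : ContMDiff 𝓘(ℝ, E) 𝓘(ℝ, F) ∞ φ)
    (hξ : SmoothAlong E φ ξ x) (hV : SmoothAlong E (fun y : M ↦ y) V x) :
    SmoothAlong E φ (fun y ↦ normalNabla φ ξ y (V y)) x := by
  have h := SmoothAlong.nablaAlong_apply hφ hV hξ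
  refine h.sub (SmoothAlong.map_mfderiv hφ (.of_inner fun Z hZ ↦ ?_))
  simp only [IsIsometricImmersion.inner_tangentPart]
  exact h.inner_fun (hZ.map_mfderiv hφ)

/-- The Gauss and Codazzi equations. -/
lemma IsIsometricImmersion.curvature_mfderiv (hφ : IsIsometricImmersion E F φ)
    (u v w : TangentSpace 𝓘(ℝ, E) x) :
    curvature (mfderiv 𝓘(ℝ, E) 𝓘(ℝ, F) φ x u) (mfderiv 𝓘(ℝ, E) 𝓘(ℝ, F) φ x v)
        (mfderiv 𝓘(ℝ, E) 𝓘(ℝ, F) φ x w) =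
      mfderiv 𝓘(ℝ, E) 𝓘(ℝ, F) φ x (curvature u v w
        - shapeOperator φ x (secondFundamentalForm F φ x v w) u
        + shapeOperator φ x (secondFundamentalForm F φ x u w) v)
      + (nablaB F φ x u v w - nablaB F φ x v u w) := by
  have hu := smoothAlong_extend (F := E) u
  have hv := smoothAlong_extend (F := E) v
  have hw := smoothAlong_extend (F := E) w
  -- The Gauss formula for the inner derivative, then the Gauss formula on its tangential and the
  -- Weingarten formula on its normal part.
  have h2 {U V : Π y : M, TangentSpace 𝓘(ℝ, E) y} (hV : SmoothAlong E (fun y : M ↦ y) V x) :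
      nablaAlong φ (fun y ↦ nablaAlong φ (fun y ↦ mfderiv 𝓘(ℝ, E) 𝓘(ℝ, F) φ y (extend E w y))
        y (V y)) x (U x) =
      mfderiv 𝓘(ℝ, E) 𝓘(ℝ, F) φ x
          (leviCivita E M (fun y ↦ leviCivita E M (extend E w) y (V y)) x (U x))
        + secondFundamentalForm F φ x (U x) (leviCivita E M (extend E w) x (V x))
        + (normalNabla φ (fun y ↦ secondFundamentalForm F φ y (V y) (extend E w y)) x (U x)
        - mfderiv 𝓘(ℝ, E) 𝓘(ℝ, F) φ x
          (shapeOperator φ x (secondFundamentalForm F φ x (V x) (extend E w x)) (U x))) := by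
    have hB := SmoothAlong.secondFundamentalForm_apply (F := F) hφ.smooth hV hw
    have hD := hV.leviCivita_apply hw
    rw [← hφ.nablaAlong_normal hB (fun y z ↦ hφ.inner_secondFundamentalForm _ _ z),
      ← nablaAlong_mfderiv hφ.smooth hD, ← _root_.add_apply,
      ← nablaAlong_add (hD.map_mfderiv hφ.smooth).mdiffAlong hB.mdiffAlong]
    congr 1
    refine nablaAlong_congr ?_
    filter_upwards [hw.eventually] with y hy
    rw [nablaAlong_mfderiv hφ.smooth hy, Pi.add_apply]
  have h := nablaAlong_curvature hφ.smooth hu hv (hw.map_mfderiv hφ.smooth)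
  rw [h2 hu, h2 hv, nablaAlong_mfderiv hφ.smooth hw] at h
  have hb := leviCivita_torsion_free hu.mdiffAlong hv.mdiffAlong
  have hB : secondFundamentalForm F φ x (VectorField.mlieBracket 𝓘(ℝ, E) (extend E u) (extend E v) x) w
      = secondFundamentalForm F φ x (leviCivita E M (extend E v) x u) w
      - secondFundamentalForm F φ x (leviCivita E M (extend E u) x v) w := by
    rw [hb, FiberBundle.extend_apply_self, FiberBundle.extend_apply_self]
    simp only [secondFundamentalForm, map_sub]
    abel
  simp only [FiberBundle.extend_apply_self, hB] at h
  rw [← h]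
  simp only [curvature, nablaB, map_sub, map_add]
  abel

end Submanifold

/-! ### Rough Laplacian of a normal field and Lagrangian frames -/

section Bitension

set_option linter.unusedSectionVars false

variable {E : Type*} [NormedAddCommGroup E] [NormedSpace ℝ E] [FiniteDimensional ℝ E]
  {M : Type*} [TopologicalSpace M] [ChartedSpace E M] [IsManifold 𝓘(ℝ, E) ∞ M]
  [RiemannianBundle (fun x : M ↦ TangentSpace 𝓘(ℝ, E) x)]
  [IsContMDiffRiemannianBundle 𝓘(ℝ, E) ∞ E (fun x : M ↦ TangentSpace 𝓘(ℝ, E) x)]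
  {F : Type*} [NormedAddCommGroup F] [NormedSpace ℝ F] [FiniteDimensional ℝ F]
  {N : Type*} [TopologicalSpace N] [ChartedSpace F N] [IsManifold 𝓘(ℝ, F) ∞ N]
  [RiemannianBundle (fun p : N ↦ TangentSpace 𝓘(ℝ, F) p)]
  [IsContMDiffRiemannianBundle 𝓘(ℝ, F) ∞ F (fun p : N ↦ TangentSpace 𝓘(ℝ, F) p)]
  {φ : M → N} {x : M} {ξ : Π y : M, TangentSpace 𝓘(ℝ, F) (φ y)}
  {J : Π p : N, TangentSpace 𝓘(ℝ, F) p →L[ℝ] TangentSpace 𝓘(ℝ, F) p}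

/-- Holds also for `m = 0`, where the inverse is `0` but the tension field is an empty sum. -/
lemma smul_meanCurvature :
    (finrank ℝ E : ℝ) • meanCurvature E F φ x = tension E F φ x := by
  rcases Nat.eq_zero_or_pos (finrank ℝ E) with h | h
  · have : IsEmpty (Fin (finrank ℝ (TangentSpace 𝓘(ℝ, E) x))) := by
      have : finrank ℝ (TangentSpace 𝓘(ℝ, E) x) = 0 := h
      rw [this]
      infer_instance
    simp [h, tension, trace]
  · rw [meanCurvature, smul_inv_smul₀ (by positivity)]

lemma smoothAlong_meanCurvature (hφ : ContMDiff 𝓘(ℝ, E) 𝓘(ℝ, F) ∞ φ) :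
    SmoothAlong E φ (meanCurvature E F φ) x :=
  (smoothAlong_tension hφ).const_smul _

lemma IsIsometricImmersion.inner_meanCurvature (hφ : IsIsometricImmersion E F φ)
    (w : TangentSpace 𝓘(ℝ, E) x) :
    inner ℝ (meanCurvature E F φ x) (mfderiv 𝓘(ℝ, E) 𝓘(ℝ, F) φ x w) = 0 := by
  simp only [meanCurvature, tension, trace, inner_smul_left, sum_inner,
    hφ.inner_secondFundamentalForm, Finset.sum_const_zero, mul_zero]

lemma roughLaplacian_const_smul (hφ : ContMDiff 𝓘(ℝ, E) 𝓘(ℝ, F) ∞ φ) (c : ℝ)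
    (hξ : ∀ y, SmoothAlong E φ ξ y) :
    roughLaplacian (fun V y (v : TangentSpace 𝓘(ℝ, E) y) ↦ nablaAlong φ V y v)
        (fun y ↦ c • ξ y) x =
      c • roughLaplacian (fun V y (v : TangentSpace 𝓘(ℝ, E) y) ↦ nablaAlong φ V y v) ξ x := by
  simp only [roughLaplacian, trace, smul_neg, Finset.smul_sum]
  congr 1
  refine Finset.sum_congr rfl fun i _ ↦ ?_
  have h := SmoothAlong.nablaAlong_apply hφ
    (smoothAlong_extend (F := E) (stdOrthonormalBasis ℝ (TangentSpace 𝓘(ℝ, E) x) i)) (hξ x)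
  rw [nablaAlong_const_smul c (hξ x).mdiffAlong, smul_sub, ← _root_.smul_apply,
    ← nablaAlong_const_smul c h.mdiffAlong, _root_.smul_apply]
  congr 2
  refine nablaAlong_congr (Eventually.of_forall fun y ↦ ?_)
  rw [nablaAlong_const_smul c (hξ y).mdiffAlong, _root_.smul_apply]

/-- The rough Laplacian of a normal field, split into its tangential and its normal part. -/
lemma IsIsometricImmersion.roughLaplacian_normal (hφ : IsIsometricImmersion E F φ)
    (hξ : ∀ y, SmoothAlong E φ ξ y)
    (hn : ∀ (y : M) (w : TangentSpace 𝓘(ℝ, E) y),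
      inner ℝ (ξ y) (mfderiv 𝓘(ℝ, E) 𝓘(ℝ, F) φ y w) = 0) :
    roughLaplacian (fun V y (v : TangentSpace 𝓘(ℝ, E) y) ↦ nablaAlong φ V y v) ξ x =
      mfderiv 𝓘(ℝ, E) 𝓘(ℝ, F) φ x
        (trace (fun u v : TangentSpace 𝓘(ℝ, E) x ↦ nablaShape φ ξ x u v)
          + trace (fun u v : TangentSpace 𝓘(ℝ, E) x ↦
              shapeOperator φ x (normalNabla φ ξ x u) v))
      + (roughLaplacian (normalNabla (E := E) φ) ξ x
          + trace (fun u v : TangentSpace 𝓘(ℝ, E) x ↦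
              secondFundamentalForm F φ x (shapeOperator φ x (ξ x) u) v)) := by
  -- The Weingarten formula applied twice. The sign in front of the rough Laplacian later makes the
  -- subtracted terms positive.
  have h (e : TangentSpace 𝓘(ℝ, E) x) :
      nablaAlong φ (fun y ↦ nablaAlong φ ξ y (extend E e y)) x e
          - nablaAlong φ ξ x (leviCivita E M (extend E e) x e) =
        (normalNabla φ (fun y ↦ normalNabla φ ξ y (extend E e y)) x e
          - normalNabla φ ξ x (leviCivita E M (extend E e) x e))
        - secondFundamentalForm F φ x (shapeOperator φ x (ξ x) e) e
        - mfderiv 𝓘(ℝ, E) 𝓘(ℝ, F) φ x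
          (nablaShape φ ξ x e e + shapeOperator φ x (normalNabla φ ξ x e) e) := by
    have he := smoothAlong_extend (F := E) e
    have h1 := SmoothAlong.normalNabla_apply hφ.smooth (hξ x) he
    have h2 := SmoothAlong.shapeOperator_apply hφ.smooth (hξ x) he
    rw [nablaAlong_congr (V := (fun y ↦ normalNabla φ ξ y (extend E e y)) -
        fun y ↦ mfderiv 𝓘(ℝ, E) 𝓘(ℝ, F) φ y (shapeOperator φ y (ξ y) (extend E e y)))
      (Eventually.of_forall fun y ↦ hφ.nablaAlong_normal (hξ y) hn _),
      nablaAlong_sub h1 (h2.map_mfderiv hφ.smooth), _root_.sub_apply,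
      hφ.nablaAlong_normal h1 (fun y w ↦ hφ.inner_normalPart _ w),
      nablaAlong_mfderiv hφ.smooth h2, hφ.nablaAlong_normal (hξ x) hn,
      secondFundamentalForm_symm hφ.smooth e]
    simp only [FiberBundle.extend_apply_self, nablaShape, map_add, map_sub]
    abel
  simp only [roughLaplacian, trace, h, Finset.sum_sub_distrib, map_sum, map_add,
    Finset.sum_add_distrib]
  abel

/-- An orthonormal basis of the tangent space of a Lagrangian submanifold and its image under the
complex structure form an orthonormal basis of the ambient tangent space. -/
lemma IsIsometricImmersion.orthonormal_lagrangian (hφ : IsIsometricImmersion E F φ)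
    (hJ : IsKahler J) (hL : IsTotallyReal E J φ) {ι : Type*} {e : ι → TangentSpace 𝓘(ℝ, E) x}
    (he : Orthonormal ℝ e) :
    Orthonormal ℝ (Sum.elim (fun i ↦ mfderiv 𝓘(ℝ, E) 𝓘(ℝ, F) φ x (e i))
      fun i ↦ J (φ x) (mfderiv 𝓘(ℝ, E) 𝓘(ℝ, F) φ x (e i))) := by
  classical
  rw [orthonormal_iff_ite] at he ⊢
  rintro (i | i) (j | j)
  · simp only [Sum.elim_inl, hφ.isometric, he, Sum.inl.injEq]
  · simp only [Sum.elim_inl, Sum.elim_inr, reduceCtorEq, if_false]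
    rw [real_inner_comm, hL]
  · simp only [Sum.elim_inl, Sum.elim_inr, reduceCtorEq, if_false, hL x]
  · simp only [Sum.elim_inr, hJ.hermitian, hφ.isometric, he, Sum.inr.injEq]

variable (hEF : finrank ℝ F = 2 * finrank ℝ E)
include hEF

lemma card_lagrangian_frame :
    Fintype.card (Fin (finrank ℝ (TangentSpace 𝓘(ℝ, E) x)) ⊕
      Fin (finrank ℝ (TangentSpace 𝓘(ℝ, E) x))) = finrank ℝ F := by
  have h : finrank ℝ (TangentSpace 𝓘(ℝ, E) x) = finrank ℝ E := rfl
  rw [Fintype.card_sum, Fintype.card_fin, h, hEF, two_mul]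

/-- By the dimension hypothesis the normal space is exactly `J dφ(T_xM)`, so the normal part is
given by its coefficients along the `J dφ(e_i)`. -/
lemma IsIsometricImmersion.eq_tangent_add_normal (hφ : IsIsometricImmersion E F φ)
    (hJ : IsKahler J) (hL : IsTotallyReal E J φ) (u : TangentSpace 𝓘(ℝ, F) (φ x)) :
    u = mfderiv 𝓘(ℝ, E) 𝓘(ℝ, F) φ x (tangentPart E φ x u)
      + trace fun v w : TangentSpace 𝓘(ℝ, E) x ↦
        (inner ℝ u (J (φ x) (mfderiv 𝓘(ℝ, E) 𝓘(ℝ, F) φ x v)) : ℝ) •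
          J (φ x) (mfderiv 𝓘(ℝ, E) 𝓘(ℝ, F) φ x w) := by
  have h := sum_inner_smul_of_orthonormal (card_lagrangian_frame hEF)
    (hφ.orthonormal_lagrangian hJ hL
      (stdOrthonormalBasis ℝ (TangentSpace 𝓘(ℝ, E) x)).orthonormal) u
  rw [Fintype.sum_sum_type] at h
  simp only [Sum.elim_inl, Sum.elim_inr, real_inner_comm u] at h
  conv_lhs => rw [← h]
  simp only [tangentPart, trace, map_sum, map_smul]

lemma IsIsometricImmersion.ricci_eq (hφ : IsIsometricImmersion E F φ)
    (hJ : IsKahler J) (hL : IsTotallyReal E J φ) (u w : TangentSpace 𝓘(ℝ, F) (φ x)) :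
    ricci u w =
      trace (fun a b : TangentSpace 𝓘(ℝ, E) x ↦ inner ℝ (curvature u
        (mfderiv 𝓘(ℝ, E) 𝓘(ℝ, F) φ x a) (mfderiv 𝓘(ℝ, E) 𝓘(ℝ, F) φ x b)) w)
      + trace (fun a b : TangentSpace 𝓘(ℝ, E) x ↦ inner ℝ (curvature u
        (J (φ x) (mfderiv 𝓘(ℝ, E) 𝓘(ℝ, F) φ x a))
        (J (φ x) (mfderiv 𝓘(ℝ, E) 𝓘(ℝ, F) φ x b))) w) := by
  have hb : IsBilinearMap ℝ fun a b : TangentSpace 𝓘(ℝ, F) (φ x) ↦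
      inner ℝ (curvature u a b) w := by
    refine ⟨fun a b c ↦ ?_, fun c a b ↦ ?_, fun a b c ↦ ?_, fun c a b ↦ ?_⟩
    · rw [curvature_add_mid, inner_add_left]
    · rw [curvature_smul_mid, inner_smul_left]; rfl
    · rw [curvature_add_right, inner_add_left]
    · rw [curvature_smul_right, inner_smul_left]; rfl
  have ho := hφ.orthonormal_lagrangian hJ hL
      (stdOrthonormalBasis ℝ (TangentSpace 𝓘(ℝ, E) x)).orthonormal
  rw [ricci, trace_eq_sum hb ho (sum_inner_smul_of_orthonormal (card_lagrangian_frame hEF) ho),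
    Fintype.sum_sum_type]
  rfl

end Bitension

/-! ### Decomposition of the bitension field and the equivalence -/

section Biharmonic

set_option linter.unusedSectionVars false

variable {E : Type*} [NormedAddCommGroup E] [NormedSpace ℝ E] [FiniteDimensional ℝ E]
  {M : Type*} [TopologicalSpace M] [ChartedSpace E M] [IsManifold 𝓘(ℝ, E) ∞ M]
  [RiemannianBundle (fun x : M ↦ TangentSpace 𝓘(ℝ, E) x)]
  [IsContMDiffRiemannianBundle 𝓘(ℝ, E) ∞ E (fun x : M ↦ TangentSpace 𝓘(ℝ, E) x)]
  {F : Type*} [NormedAddCommGroup F] [NormedSpace ℝ F] [FiniteDimensional ℝ F]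
  {N : Type*} [TopologicalSpace N] [ChartedSpace F N] [IsManifold 𝓘(ℝ, F) ∞ N]
  [RiemannianBundle (fun p : N ↦ TangentSpace 𝓘(ℝ, F) p)]
  [IsContMDiffRiemannianBundle 𝓘(ℝ, F) ∞ F (fun p : N ↦ TangentSpace 𝓘(ℝ, F) p)]
  {φ : M → N} {x : M}
  {J : Π p : N, TangentSpace 𝓘(ℝ, F) p →L[ℝ] TangentSpace 𝓘(ℝ, F) p}

/-- By the Codazzi equation, the tangential part of `∑ i, R^N(ξ, e i)(e i)` is determined by the
covariant derivative of the second fundamental form. -/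
lemma IsIsometricImmersion.tangentPart_trace_curvature (hφ : IsIsometricImmersion E F φ)
    {η : TangentSpace 𝓘(ℝ, F) (φ x)}
    (hη : ∀ w : TangentSpace 𝓘(ℝ, E) x, inner ℝ η (mfderiv 𝓘(ℝ, E) 𝓘(ℝ, F) φ x w) = 0) :
    tangentPart E φ x (trace fun v w : TangentSpace 𝓘(ℝ, E) x ↦
        curvature η (mfderiv 𝓘(ℝ, E) 𝓘(ℝ, F) φ x v) (mfderiv 𝓘(ℝ, E) 𝓘(ℝ, F) φ x w)) =
      trace (fun u v : TangentSpace 𝓘(ℝ, E) x ↦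
        (inner ℝ (trace (fun a b ↦ nablaB F φ x u a b) - trace (fun a b ↦ nablaB F φ x a u b))
          η : ℝ) • v) := by
  have h (u a : TangentSpace 𝓘(ℝ, E) x) :
      inner ℝ (curvature η (mfderiv 𝓘(ℝ, E) 𝓘(ℝ, F) φ x a) (mfderiv 𝓘(ℝ, E) 𝓘(ℝ, F) φ x a))
        (mfderiv 𝓘(ℝ, E) 𝓘(ℝ, F) φ x u) =
      inner ℝ (nablaB F φ x u a a) η - inner ℝ (nablaB F φ x a u a) η := by
    -- The curvature symmetries move `η` out of the curvature; since `η` is normal, only the Codazzi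
    -- part of `R^N(u, a)a` pairs with it.
    rw [inner_curvature_pair, curvature_antisymm, inner_neg_left, inner_curvature_skew, neg_neg,
      hφ.curvature_mfderiv, inner_add_right, hη, zero_add, inner_sub_right, real_inner_comm η,
      real_inner_comm η]
  unfold tangentPart
  congr 1
  ext u v
  congr 1
  simp only [trace, sum_inner, inner_sub_left, h, Finset.sum_sub_distrib]

variable (hEF : finrank ℝ F = 2 * finrank ℝ E)
include hEF

/-- The normal coefficients of `Jη` are `⟨Jη, J dφ e⟩ = ⟨η, dφ e⟩ = 0`. Thus `JH` is a tangent
vector of `M`. -/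
lemma IsIsometricImmersion.mfderiv_tangentPart_map (hφ : IsIsometricImmersion E F φ)
    (hJ : IsKahler J) (hL : IsTotallyReal E J φ) {η : TangentSpace 𝓘(ℝ, F) (φ x)}
    (hη : ∀ w : TangentSpace 𝓘(ℝ, E) x, inner ℝ η (mfderiv 𝓘(ℝ, E) 𝓘(ℝ, F) φ x w) = 0) :
    mfderiv 𝓘(ℝ, E) 𝓘(ℝ, F) φ x (tangentPart E φ x (J (φ x) η)) = J (φ x) η := by
  conv_rhs => rw [hφ.eq_tangent_add_normal hEF hJ hL (J (φ x) η)]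
  simp only [hJ.hermitian, hη, trace, zero_smul, Finset.sum_const_zero, add_zero]

/-- The components of `∑ i, R^N(H, e i)(e i)` normal to a Lagrangian submanifold. -/
lemma IsIsometricImmersion.inner_trace_curvature_map (hφ : IsIsometricImmersion E F φ)
    (hJ : IsKahler J) (hL : IsTotallyReal E J φ) {h : TangentSpace 𝓘(ℝ, E) x}
    (hh : mfderiv 𝓘(ℝ, E) 𝓘(ℝ, F) φ x h = J (φ x) (meanCurvature E F φ x))
    (z : TangentSpace 𝓘(ℝ, E) x) :
    inner ℝ (trace fun v w : TangentSpace 𝓘(ℝ, E) x ↦ curvature (meanCurvature E F φ x)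
        (mfderiv 𝓘(ℝ, E) 𝓘(ℝ, F) φ x v) (mfderiv 𝓘(ℝ, E) 𝓘(ℝ, F) φ x w))
        (J (φ x) (mfderiv 𝓘(ℝ, E) 𝓘(ℝ, F) φ x z)) =
      -ricci (J (φ x) (meanCurvature E F φ x)) (mfderiv 𝓘(ℝ, E) 𝓘(ℝ, F) φ x z)
      + ricci h z
      + inner ℝ (trace fun u v : TangentSpace 𝓘(ℝ, E) x ↦
          shapeOperator φ x (secondFundamentalForm F φ x h u) v) z
      - finrank ℝ E * inner ℝ (shapeOperator φ x (meanCurvature E F φ x) h) z := by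
  -- `J`-invariance of the curvature produces the part of `Ric^N` over the vectors `J dφ(e_i)`.
  have h1 (a : TangentSpace 𝓘(ℝ, E) x) :
      inner ℝ (curvature (meanCurvature E F φ x) (mfderiv 𝓘(ℝ, E) 𝓘(ℝ, F) φ x a)
        (mfderiv 𝓘(ℝ, E) 𝓘(ℝ, F) φ x a)) (J (φ x) (mfderiv 𝓘(ℝ, E) 𝓘(ℝ, F) φ x z)) =
      -inner ℝ (curvature (J (φ x) (meanCurvature E F φ x))
        (J (φ x) (mfderiv 𝓘(ℝ, E) 𝓘(ℝ, F) φ x a))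
        (J (φ x) (mfderiv 𝓘(ℝ, E) 𝓘(ℝ, F) φ x a))) (mfderiv 𝓘(ℝ, E) 𝓘(ℝ, F) φ x z) := by
    rw [← hJ.inner_curvature, hJ.curvature_map _ _ (mfderiv 𝓘(ℝ, E) 𝓘(ℝ, F) φ x a), hJ.inner_left,
      neg_neg]
  -- The part of `Ric^N` over the tangent vectors, by the Gauss equation.
  have h2 (a : TangentSpace 𝓘(ℝ, E) x) :
      inner ℝ (curvature (J (φ x) (meanCurvature E F φ x)) (mfderiv 𝓘(ℝ, E) 𝓘(ℝ, F) φ x a)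
        (mfderiv 𝓘(ℝ, E) 𝓘(ℝ, F) φ x a)) (mfderiv 𝓘(ℝ, E) 𝓘(ℝ, F) φ x z) =
      inner ℝ (curvature h a a) z
        - inner ℝ (secondFundamentalForm F φ x h z) (secondFundamentalForm F φ x a a)
        + inner ℝ (shapeOperator φ x (secondFundamentalForm F φ x h a) a) z := by
    rw [← hh, hφ.curvature_mfderiv]
    simp only [nablaB, normalNabla, inner_add_left, inner_sub_left, hφ.isometric,
      hφ.inner_normalPart, hφ.inner_secondFundamentalForm, inner_shapeOperator hφ.smooth]
    ring
  have h3 : finrank ℝ E * inner ℝ (shapeOperator φ x (meanCurvature E F φ x) h) z =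
      trace fun a b : TangentSpace 𝓘(ℝ, E) x ↦
        inner ℝ (secondFundamentalForm F φ x h z) (secondFundamentalForm F φ x a b) := by
    rw [inner_shapeOperator hφ.smooth, ← real_inner_smul_right, smul_meanCurvature, tension,
      trace, inner_sum]
    rfl
  rw [h3, hφ.ricci_eq hEF hJ hL]
  simp only [trace, sum_inner, ricci, h1, h2, Finset.sum_add_distrib, Finset.sum_sub_distrib,
    Finset.sum_neg_distrib]
  ring

omit hEF in
lemma bitension_eq_smul (hφ : ContMDiff 𝓘(ℝ, E) 𝓘(ℝ, F) ∞ φ) :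
    bitension E F φ x = (finrank ℝ E : ℝ) •
      (roughLaplacian (fun V y (v : TangentSpace 𝓘(ℝ, E) y) ↦ nablaAlong φ V y v)
          (meanCurvature E F φ) x
        - trace fun v w : TangentSpace 𝓘(ℝ, E) x ↦ curvature (meanCurvature E F φ x)
            (mfderiv 𝓘(ℝ, E) 𝓘(ℝ, F) φ x v) (mfderiv 𝓘(ℝ, E) 𝓘(ℝ, F) φ x w)) := by
  have h : tension E F φ = fun y ↦ (finrank ℝ E : ℝ) • meanCurvature E F φ y :=
    funext fun y ↦ smul_meanCurvature.symm
  rw [bitension, h, roughLaplacian_const_smul hφ _ fun y ↦ smoothAlong_meanCurvature hφ]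
  simp only [trace, curvature_smul_left, smul_sub, Finset.smul_sum]

omit hEF in
variable (E F) in
/-- The tangential part of the biharmonic equation. -/
def biharmonicTangent (φ : M → N) (x : M) : TangentSpace 𝓘(ℝ, E) x :=
  trace (fun u v : TangentSpace 𝓘(ℝ, E) x ↦ nablaShape φ (meanCurvature E F φ) x u v)
    + trace (fun u v : TangentSpace 𝓘(ℝ, E) x ↦
        shapeOperator φ x (normalNabla φ (meanCurvature E F φ) x u) v)
    - trace (fun u v : TangentSpace 𝓘(ℝ, E) x ↦
        (inner ℝ (trace (fun a b ↦ nablaB F φ x u a b) - trace (fun a b ↦ nablaB F φ x a u b))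
          (meanCurvature E F φ x) : ℝ) • v)

omit hEF in
variable (E) in
/-- The normal part of the biharmonic equation of a Lagrangian immersion. -/
def biharmonicNormal (J : Π p : N, TangentSpace 𝓘(ℝ, F) p →L[ℝ] TangentSpace 𝓘(ℝ, F) p)
    (φ : M → N) (x : M) : TangentSpace 𝓘(ℝ, F) (φ x) :=
  roughLaplacian (normalNabla (E := E) φ) (meanCurvature E F φ) x
    + trace (fun u v : TangentSpace 𝓘(ℝ, E) x ↦
        secondFundamentalForm F φ x (shapeOperator φ x (meanCurvature E F φ x) u) v)
    + trace (fun u v : TangentSpace 𝓘(ℝ, E) x ↦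
        ricci (J (φ x) (meanCurvature E F φ x)) (mfderiv 𝓘(ℝ, E) 𝓘(ℝ, F) φ x u) •
          J (φ x) (mfderiv 𝓘(ℝ, E) 𝓘(ℝ, F) φ x v))
    - trace (fun u v : TangentSpace 𝓘(ℝ, E) x ↦
        ricci (tangentPart E φ x (J (φ x) (meanCurvature E F φ x))) u •
          J (φ x) (mfderiv 𝓘(ℝ, E) 𝓘(ℝ, F) φ x v))
    - J (φ x) (mfderiv 𝓘(ℝ, E) 𝓘(ℝ, F) φ x
        (trace (fun u v : TangentSpace 𝓘(ℝ, E) x ↦ shapeOperator φ x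
          (secondFundamentalForm F φ x
            (tangentPart E φ x (J (φ x) (meanCurvature E F φ x))) u) v)))
    + (finrank ℝ E : ℝ) • J (φ x) (mfderiv 𝓘(ℝ, E) 𝓘(ℝ, F) φ x
        (shapeOperator φ x (meanCurvature E F φ x)
          (tangentPart E φ x (J (φ x) (meanCurvature E F φ x)))))

-- Each term is a normal projection, a value of `B`, or lies in `J dφ(T_xM)`. This is what lets the
-- two components be separated.
omit hEF in
lemma IsIsometricImmersion.inner_biharmonicNormal (hφ : IsIsometricImmersion E F φ)
    (hL : IsTotallyReal E J φ) (w : TangentSpace 𝓘(ℝ, E) x) :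
    inner ℝ (biharmonicNormal E J φ x) (mfderiv 𝓘(ℝ, E) 𝓘(ℝ, F) φ x w) = 0 := by
  simp only [biharmonicNormal, inner_add_left, inner_sub_left, roughLaplacian, normalNabla,
    inner_neg_left, trace, sum_inner, inner_smul_left, hL x, hφ.inner_normalPart,
    hφ.inner_secondFundamentalForm, mul_zero, Finset.sum_const_zero, sub_zero, add_zero, neg_zero]

lemma IsIsometricImmersion.bitension_eq (hφ : IsIsometricImmersion E F φ)
    (hJ : IsKahler J) (hL : IsTotallyReal E J φ) :
    bitension E F φ x = (finrank ℝ E : ℝ) •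
      (mfderiv 𝓘(ℝ, E) 𝓘(ℝ, F) φ x (biharmonicTangent E F φ x) + biharmonicNormal E J φ x) := by
  have hH := hφ.inner_meanCurvature (x := x)
  have hh := hφ.mfderiv_tangentPart_map hEF hJ hL hH
  -- Expands `J dφ z` in the frame `J dφ(e_i)`, the form in which the normal part of the curvature
  -- trace appears.
  have map_sum (z : TangentSpace 𝓘(ℝ, E) x) : J (φ x) (mfderiv 𝓘(ℝ, E) 𝓘(ℝ, F) φ x z) =
      trace fun u v : TangentSpace 𝓘(ℝ, E) x ↦
        (inner ℝ z u : ℝ) • J (φ x) (mfderiv 𝓘(ℝ, E) 𝓘(ℝ, F) φ x v) := by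
    conv_lhs => rw [← (stdOrthonormalBasis ℝ (TangentSpace 𝓘(ℝ, E) x)).sum_repr' z]
    simp only [map_sum, map_smul, trace, real_inner_comm z]
  rw [bitension_eq_smul hφ.smooth, hφ.roughLaplacian_normal
    (fun y ↦ smoothAlong_meanCurvature hφ.smooth) fun y w ↦ hφ.inner_meanCurvature w,
    hφ.eq_tangent_add_normal hEF hJ hL (trace fun v w : TangentSpace 𝓘(ℝ, E) x ↦
      curvature (meanCurvature E F φ x) _ _), hφ.tangentPart_trace_curvature hH]
  simp only [hφ.inner_trace_curvature_map hEF hJ hL hh, biharmonicTangent, biharmonicNormal]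
  rw [map_sum (trace _), map_sum (shapeOperator _ _ _ _)]
  rw [map_sub]
  congr 1
  simp only [trace, add_smul, sub_smul, neg_smul, mul_smul, Finset.sum_add_distrib,
    Finset.sum_sub_distrib, Finset.sum_neg_distrib, Finset.smul_sum]
  abel

lemma IsIsometricImmersion.isBiharmonic_iff (hφ : IsIsometricImmersion E F φ)
    (hJ : IsKahler J) (hL : IsTotallyReal E J φ) :
    IsBiharmonic E F φ ↔
      (∀ x, biharmonicTangent E F φ x = 0) ∧ ∀ x, biharmonicNormal E J φ x = 0 := by
  refine ⟨fun h ↦ ?_, fun h x ↦ by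
    rw [hφ.bitension_eq hEF hJ hL, h.1, h.2, map_zero, add_zero, smul_zero]⟩
  rw [← forall_and]
  intro x
  -- For `m = 0` the factor `m` of the bitension field cannot be cancelled, but then all tangent
  -- spaces involved are zero.
  rcases Nat.eq_zero_or_pos (finrank ℝ E) with hE | hE
  · have : Subsingleton (TangentSpace 𝓘(ℝ, E) x) := (Module.finrank_zero_iff (R := ℝ) (M := E)).1 hE
    have : Subsingleton (TangentSpace 𝓘(ℝ, F) (φ x)) :=
      (Module.finrank_zero_iff (R := ℝ) (M := F)).1 (by rw [hEF, hE])
    exact ⟨Subsingleton.elim _ _, Subsingleton.elim _ _⟩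
  have h0 := h x
  rw [hφ.bitension_eq hEF hJ hL, smul_eq_zero_iff_right (by positivity)] at h0
  have h1 : biharmonicTangent E F φ x = 0 := by
    refine ext_inner_right ℝ fun w ↦ ?_
    rw [← hφ.isometric, eq_neg_of_add_eq_zero_left h0, inner_neg_left,
      hφ.inner_biharmonicNormal hL, neg_zero, inner_zero_left]
  exact ⟨h1, by rwa [h1, map_zero, zero_add] at h0⟩

end Biharmonic

end LagrangianBiharmonic

end

theorem theorem2p2
    {E : Type*} [NormedAddCommGroup E] [NormedSpace ℝ E] [FiniteDimensional ℝ E]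
    {M : Type*} [TopologicalSpace M] [ChartedSpace E M] [IsManifold 𝓘(ℝ, E) ∞ M]
    [RiemannianBundle (fun x : M ↦ TangentSpace 𝓘(ℝ, E) x)]
    [IsContMDiffRiemannianBundle 𝓘(ℝ, E) ∞ E (fun x : M ↦ TangentSpace 𝓘(ℝ, E) x)]
    {F : Type*} [NormedAddCommGroup F] [NormedSpace ℝ F] [FiniteDimensional ℝ F]
    {N : Type*} [TopologicalSpace N] [ChartedSpace F N] [IsManifold 𝓘(ℝ, F) ∞ N]
    [RiemannianBundle (fun p : N ↦ TangentSpace 𝓘(ℝ, F) p)]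
    [IsContMDiffRiemannianBundle 𝓘(ℝ, F) ∞ F (fun p : N ↦ TangentSpace 𝓘(ℝ, F) p)]
    (m : ℕ) (hM : finrank ℝ E = m) (hN : finrank ℝ F = 2 * m)
    (J : Π p : N, TangentSpace 𝓘(ℝ, F) p →L[ℝ] TangentSpace 𝓘(ℝ, F) p)
    (hJ : LagrangianBiharmonic.IsKahler J)
    (φ : M → N) (hφ : LagrangianBiharmonic.IsIsometricImmersion E F φ)
    (hL : LagrangianBiharmonic.IsTotallyReal E J φ) :
    open LagrangianBiharmonic in
    IsBiharmonic E F φ ↔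
      (∀ x : M,
        trace (fun u v : TangentSpace 𝓘(ℝ, E) x ↦ nablaShape φ (meanCurvature E F φ) x u v)
          + trace (fun u v : TangentSpace 𝓘(ℝ, E) x ↦ shapeOperator φ x (normalNabla φ (meanCurvature E F φ) x u) v)
          - trace (fun u v : TangentSpace 𝓘(ℝ, E) x ↦
              (inner ℝ (trace (fun a b ↦ nablaB F φ x u a b) - trace (fun a b ↦ nablaB F φ x a u b))
                (meanCurvature E F φ x) : ℝ) • v)
          = 0) ∧
      (∀ x : M,
        roughLaplacian (normalNabla (E := E) φ) (meanCurvature E F φ) x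
          + trace (fun u v : TangentSpace 𝓘(ℝ, E) x ↦
              secondFundamentalForm F φ x (shapeOperator φ x (meanCurvature E F φ x) u) v)
          + trace (fun u v : TangentSpace 𝓘(ℝ, E) x ↦
              ricci (J (φ x) (meanCurvature E F φ x)) (mfderiv 𝓘(ℝ, E) 𝓘(ℝ, F) φ x u) •
                J (φ x) (mfderiv 𝓘(ℝ, E) 𝓘(ℝ, F) φ x v))
          - trace (fun u v : TangentSpace 𝓘(ℝ, E) x ↦
              ricci (tangentPart E φ x (J (φ x) (meanCurvature E F φ x))) u •
                J (φ x) (mfderiv 𝓘(ℝ, E) 𝓘(ℝ, F) φ x v))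
          - J (φ x) (mfderiv 𝓘(ℝ, E) 𝓘(ℝ, F) φ x
              (trace (fun u v : TangentSpace 𝓘(ℝ, E) x ↦ shapeOperator φ x
                (secondFundamentalForm F φ x
                  (tangentPart E φ x (J (φ x) (meanCurvature E F φ x))) u) v)))
          + (m : ℝ) • J (φ x) (mfderiv 𝓘(ℝ, E) 𝓘(ℝ, F) φ x
              (shapeOperator φ x (meanCurvature E F φ x)
                (tangentPart E φ x (J (φ x) (meanCurvature E F φ x)))))
          = 0) := by
  subst hM
  exact hφ.isBiharmonic_iff hN hJ hL
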